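/- **Setting.** For $k=(k_1,k_2)\in\mathbb Z^2$ let $\|k\|$ be the Euclidean norm. For $p,q\in\mathbb Z^2$ put $$A(p,q)=\tfrac12\Big[\tfrac1{\|p\|^2}-\tfrac1{\|q\|^2}\Big](p_1q_2-q_1p_2)$$ if $p\ne0$, $q\neq 0$, $p\neq\pm q$, and $A(p,q)=0$ otherwise. Fix $p\in\mathbb Z^2\setminus\{0\}$ and $\Gamma\in\mathbb C$. The linearized Euler operator $L$ on $\ell^2(\mathbb Z^2)$ is $$(L\omega)_k=A(p,k-p)\,\Gamma\,\omega_{k-p}+A(-p,k+p)\,\overline\Gamma\,\omega_{k+p},\qquad k\in\mathbb Z^2,$$ with its maximal domain $\{\omega\in\ell^2(\mathbb Z^2): L\omega\in\ell^2(\mathbb Z^2)\}$. For $q\in\mathbb Z^2$ let $\Sigma_q=\{q+np:n\in\mathbb Z\}$, and let $Q$ be the set of representatives that contains from each $\Sigma_q$ the point of minimal norm (if there are two such points, the one $q+np$ with the larger $n$). For $q\in Q$ let $L_q=VD-V^*D^*$ on $\ell^2(\mathbb Z)$, where $(V\omega)_n=\omega_{n-1}$ and $(D\omega)_n=A(q+np,p)\,\Gamma\,\omega_n$;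 thus $L=\bigoplus_{q\in Q}L_q$. Put $$\beta=\beta(q)=-\frac{1}{2\|p\|^2}(q_1p_2-p_1q_2)\,\Gamma .$$ $\sigma$ and $\sigma_p$ denote the spectrum and the point spectrum (the set of eigenvalues). $\sigma_{\rm ess}$ is the spectrum minus the discrete spectrum, the latter being the set of isolated points of the spectrum whose Riesz projection has finite rank. **Theorem.** (a) For each $q\in Q$, $$\sigma_{\rm ess}(L_q)=\sigma(V\beta-V^*\overline\beta)=i[-2|\beta|,2|\beta|].$$ (b) $\sigma(L)=\bigcup_{q\in Q}\sigma(L_q)$. (c) If $\Gamma\ne0$, then $\sigma_{\rm ess}(L)=i\mathbb R$. Moreover (for every $\Gamma$) $$\sigma_p(L)\setminus i\mathbb R=\bigcup_{q\in Q,\ \|q\|\le\|p\|}\big(\sigma_p(L_q)\setminus i\mathbb R\big),$$ and this set is bounded and has accumulation points only on $i\mathbb R$. -/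

import Mathlib

open scoped lp ComplexConjugate

noncomputable section

namespace LinEuler

/-! ### Spectral theory -/

section Spectral

variable {E : Type*} [NormedAddCommGroup E] [NormedSpace ℂ E]

/-- `R` is a bounded two-sided inverse of `z - A : dom A → E`. -/
structure IsResolventAt (A : E →ₗ.[ℂ] E) (z : ℂ) (R : E →L[ℂ] E) : Prop where
  mem_domain : ∀ y, R y ∈ A.domain
  right_inv : ∀ y, z • R y - A ⟨R y, mem_domain y⟩ = y
  left_inv : ∀ x : A.domain, R (z • (x : E) - A x) = x

/-- The spectrum of a (possibly unbounded) operator: all `z` such that `z - A` has no bounded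
everywhere defined inverse. -/
def pmapSpectrum (A : E →ₗ.[ℂ] E) : Set ℂ :=
  {z | ¬ ∃ R, IsResolventAt A z R}

open Classical in
/-- The resolvent function `z ↦ (z - A)⁻¹` of a (possibly unbounded) operator
(with the value `0` on the spectrum; the inverse is unique off the spectrum). -/
def pmapResolvent (A : E →ₗ.[ℂ] E) (z : ℂ) : E →L[ℂ] E :=
  if h : ∃ R, IsResolventAt A z R then h.choose else 0

/-- The point spectrum of a (possibly unbounded) operator. -/
def pmapPointSpectrum (A : E →ₗ.[ℂ] E) : Set ℂ :=
  {z | ∃ x : A.domain, (x : E) ≠ 0 ∧ A x = z • (x : E)}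

/-- The point spectrum of a bounded operator. -/
def pointSpectrum (T : E →L[ℂ] E) : Set ℂ :=
  {z | Module.End.HasEigenvalue (T : E →ₗ[ℂ] E) z}

/-- The Riesz integral `(2πi)⁻¹ ∮ R(z) dz` over the circle of radius `r` around `c`. -/
def rieszIntegral (R : ℂ → E →L[ℂ] E) (c : ℂ) (r : ℝ) : E →L[ℂ] E :=
  (2 * Real.pi * Complex.I : ℂ)⁻¹ • ∮ z in C(c, r), R z

/-- The discrete spectrum of an operator with spectrum `σ` and resolvent function `R`: isolated
points of the spectrum whose Riesz projection has finite rank. -/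
def discreteSpectrum (σ : Set ℂ) (R : ℂ → E →L[ℂ] E) : Set ℂ :=
  {c | ∃ r : ℝ, 0 < r ∧ Metric.closedBall c r ∩ σ = {c} ∧
    FiniteDimensional ℂ (LinearMap.range (rieszIntegral R c r : E →ₗ[ℂ] E))}

/-- The essential spectrum of a bounded operator: the complement of the discrete spectrum in the
spectrum. -/
def essSpectrum (T : E →L[ℂ] E) : Set ℂ :=
  spectrum ℂ T \ discreteSpectrum (spectrum ℂ T) (resolvent T)

/-- The essential spectrum of a (possibly unbounded) operator. -/
def pmapEssSpectrum (A : E →ₗ.[ℂ] E) : Set ℂ :=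
  pmapSpectrum A \ discreteSpectrum (pmapSpectrum A) (pmapResolvent A)

end Spectral

/-! ### The grid `ℤ²` -/

/-- The Euclidean norm on `ℤ²`. -/
def eucNorm (k : ℤ × ℤ) : ℝ := Real.sqrt ((k.1 : ℝ) ^ 2 + (k.2 : ℝ) ^ 2)

/-- The determinant with columns `p` and `q`. -/
def det2 (p q : ℤ × ℤ) : ℝ := (p.1 : ℝ) * q.2 - (q.1 : ℝ) * p.2

/-- The interaction coefficients of the vorticity equation. -/
def coefA (p q : ℤ × ℤ) : ℝ :=
  if p = 0 ∨ q = 0 ∨ p = q ∨ p = -q then 0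
  else 1 / 2 * (1 / eucNorm p ^ 2 - 1 / eucNorm q ^ 2) * det2 p q

/-- `Σ_q = {q + n p : n ∈ ℤ}`. -/
def slice (p q : ℤ × ℤ) : Set (ℤ × ℤ) := Set.range fun n : ℤ => q + n • p

/-- `q' ∈ Σ_q` is the distinguished representative of `Σ_q`: it has minimal Euclidean norm in
`Σ_q`, and among the points of `Σ_q` with this norm it is the one with the largest index. -/
def IsRep (p q q' : ℤ × ℤ) : Prop :=
  IsLeast (eucNorm '' slice p q) (eucNorm q') ∧
    ∃ n : ℤ, q' = q + n • p ∧ IsGreatest {m : ℤ | eucNorm q' = eucNorm (q + m • p)} n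

/-- The set `Q` of all distinguished representatives. -/
def reps (p : ℤ × ℤ) : Set (ℤ × ℤ) := {q' | ∃ q, IsRep p q q'}

/-! ### The linearized Euler operator on `ℓ²(ℤ²)` -/

/-- The action of the linearized Euler operator on arbitrary sequences. -/
def formalL (p : ℤ × ℤ) (Γ : ℂ) (ω : ℤ × ℤ → ℂ) (k : ℤ × ℤ) : ℂ :=
  coefA p (k - p) * Γ * ω (k - p) + coefA (-p) (k + p) * conj Γ * ω (k + p)

theorem formalL_add (p : ℤ × ℤ) (Γ : ℂ) (ω η : ℤ × ℤ → ℂ) :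
    formalL p Γ (ω + η) = formalL p Γ ω + formalL p Γ η := by
  funext k
  simp only [formalL, Pi.add_apply]
  ring

theorem formalL_smul (p : ℤ × ℤ) (Γ c : ℂ) (ω : ℤ × ℤ → ℂ) :
    formalL p Γ (c • ω) = c • formalL p Γ ω := by
  funext k
  simp only [formalL, Pi.smul_apply, smul_eq_mul]
  ring

/-- The linearized Euler operator `L` on `ℓ²(ℤ²)` with its maximal domain
`{ω ∈ ℓ²(ℤ²) : L ω ∈ ℓ²(ℤ²)}`. -/
def eulerL (p : ℤ × ℤ) (Γ : ℂ) : ℓ²(ℤ × ℤ, ℂ) →ₗ.[ℂ] ℓ²(ℤ × ℤ, ℂ) where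
  domain :=
    { carrier := {ω | Memℓp (formalL p Γ ω) 2}
      zero_mem' := by
        have h : formalL p Γ (⇑(0 : ℓ²(ℤ × ℤ, ℂ))) = 0 := by
          funext k
          simp [formalL]
        change Memℓp (formalL p Γ (⇑(0 : ℓ²(ℤ × ℤ, ℂ)))) 2
        rw [h]
        exact zero_memℓp
      add_mem' := by
        intro ω η hω hη
        change Memℓp (formalL p Γ (⇑(ω + η))) 2
        rw [lp.coeFn_add, formalL_add]
        exact Memℓp.add hω hη
      smul_mem' := by
        intro c ω hω
        change Memℓp (formalL p Γ (⇑(c • ω))) 2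
        rw [lp.coeFn_smul, formalL_smul]
        exact Memℓp.const_smul hω c }
  toFun :=
    { toFun := fun ω => ⟨formalL p Γ (ω : ℓ²(ℤ × ℤ, ℂ)), ω.2⟩
      map_add' := by
        intro ω η
        apply lp.ext
        exact formalL_add p Γ _ _
      map_smul' := by
        intro c ω
        apply lp.ext
        exact formalL_smul p Γ c _ }

/-! ### The slice operators on `ℓ²(ℤ)` -/

theorem memℓp_shift (ω : ℓ²(ℤ, ℂ)) : Memℓp (fun n : ℤ => ω (n - 1)) 2 := by
  have h := (lp.memℓp ω).summable (by simp)
  exact memℓp_gen ((Equiv.subRight (1 : ℤ)).summable_iff.mpr h)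

/-- The shift `V : (ω_n) ↦ (ω_{n-1})` on `ℓ²(ℤ)`. -/
def shiftV : ℓ²(ℤ, ℂ) →L[ℂ] ℓ²(ℤ, ℂ) :=
  LinearMap.mkContinuous
    { toFun := fun ω => ⟨fun n => ω (n - 1), memℓp_shift ω⟩
      map_add' := fun _ _ => rfl
      map_smul' := fun _ _ => rfl } 1 <| by
    intro ω
    rw [one_mul, lp.norm_eq_tsum_rpow (by simp), lp.norm_eq_tsum_rpow (by simp)]
    refine le_of_eq (congrArg (fun t : ℝ => t ^ (1 / (2 : ENNReal).toReal)) ?_)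
    exact (Equiv.subRight (1 : ℤ)).tsum_eq (fun n => ‖ω n‖ ^ (2 : ENNReal).toReal)

theorem one_le_eucNorm_sq {k : ℤ × ℤ} (hk : k ≠ 0) : 1 ≤ eucNorm k ^ 2 := by
  rw [eucNorm, Real.sq_sqrt (by positivity)]
  have h : 0 < k.1 ^ 2 + k.2 ^ 2 := by
    by_contra hn
    apply hk
    ext
    · simp only [Prod.fst_zero]; nlinarith [sq_nonneg k.1, sq_nonneg k.2]
    · simp only [Prod.snd_zero]; nlinarith [sq_nonneg k.1, sq_nonneg k.2]
  exact_mod_cast h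

theorem abs_coefA_le (p q : ℤ × ℤ) (n : ℤ) : |coefA (q + n • p) p| ≤ |det2 q p| := by
  unfold coefA
  split_ifs with h
  · simp
  · simp only [not_or] at h
    have h1 := one_le_eucNorm_sq h.1
    have h2 := one_le_eucNorm_sq h.2.1
    have h3 : det2 (q + n • p) p = det2 q p := by
      simp only [det2, Prod.fst_add, Prod.snd_add, Prod.smul_fst, Prod.smul_snd, smul_eq_mul]
      push_cast
      ring
    rw [h3, abs_mul]
    refine mul_le_of_le_one_left (abs_nonneg _) ?_
    have b1 : 1 / eucNorm (q + n • p) ^ 2 ≤ 1 := by rw [div_le_one (by linarith)]; exact h1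
    have b2 : 1 / eucNorm p ^ 2 ≤ 1 := by rw [div_le_one (by linarith)]; exact h2
    have c1 : 0 ≤ 1 / eucNorm (q + n • p) ^ 2 := by positivity
    have c2 : 0 ≤ 1 / eucNorm p ^ 2 := by positivity
    rw [abs_le]
    constructor <;> linarith

/-- The diagonal operator `D : (ω_n) ↦ (A(q + n p, p) Γ ω_n)` on `ℓ²(ℤ)`. -/
def diagD (p q : ℤ × ℤ) (Γ : ℂ) : ℓ²(ℤ, ℂ) →L[ℂ] ℓ²(ℤ, ℂ) :=
  lp.mapCLM 2 (fun n : ℤ => (coefA (q + n • p) p * Γ : ℂ) • ContinuousLinearMap.id ℂ ℂ)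
    (K := |det2 q p| * ‖Γ‖) (by positivity) <| by
    intro n
    rw [norm_smul, ContinuousLinearMap.norm_id, mul_one, norm_mul, Complex.norm_real,
      Real.norm_eq_abs]
    exact mul_le_mul_of_nonneg_right (abs_coefA_le p q n) (norm_nonneg _)

/-- The slice operator `L_q = V D - V* D*`. -/
def sliceL (p q : ℤ × ℤ) (Γ : ℂ) : ℓ²(ℤ, ℂ) →L[ℂ] ℓ²(ℤ, ℂ) :=
  shiftV ∘L diagD p q Γ -
    ContinuousLinearMap.adjoint shiftV ∘L ContinuousLinearMap.adjoint (diagD p q Γ)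

/-- The number `β = β(q)`. -/
def beta (p q : ℤ × ℤ) (Γ : ℂ) : ℂ := -(1 / (2 * (eucNorm p : ℂ) ^ 2)) * det2 q p * Γ

/-- The constant coefficient operator `V β - V* β̄`. -/
def sliceL0 (p q : ℤ × ℤ) (Γ : ℂ) : ℓ²(ℤ, ℂ) →L[ℂ] ℓ²(ℤ, ℂ) :=
  beta p q Γ • shiftV - conj (beta p q Γ) • ContinuousLinearMap.adjoint shiftV

/-- The imaginary axis `iℝ`. -/
def imagAxis : Set ℂ := {z | z.re = 0}

end LinEuler

end

open LinEuler

open scoped lp ComplexConjugate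

noncomputable section

namespace LinEuler

/-! ### Resolvent identities in an algebra. -/

section Resolvent

variable {A : Type*} [Ring A] [Algebra ℂ A]

/-! Since `L` couples `k` only to `k ± p`, it splits over the lines `q + ℤp` into the bounded
operators `L_q = VD - V*D*`. The determinant factor of `A(q + np, p)` is constant along a line, and
`‖q + np‖⁻² → 0`, so the diagonal of `D` tends to `β`.

Essential spectrum of `L_q`. The operator `Vβ - V*β̄` is skew-adjoint of norm at most `2|β|`, so
every point off the segment `i[-2|β|, 2|β|]` is separated from its numerical range by a half plane
(`exists_halfPlane`). Up to an arbitrarily small error, `L_q` differs from it by a finite rank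
operator. Analytic Fredholm theory, reduced to a determinant (`exists_finiteRank_rieszIntegral`),
therefore leaves only discrete spectrum off the segment. Conversely, plane waves truncated to a long
window far out are approximate eigenvectors for every point of the segment
(`IsDiag.imagSegment_subset_spectrum`). A segment with `β ≠ 0` has no isolated points; if `β = 0`,
then `L_q = 0`, whose Riesz projection at `0` is the identity of an infinite-dimensional space.

Spectrum of `L`. A direct sum is invertible if the inverses of the summands are uniformly bounded.
Only finitely many representatives satisfy `‖q‖ ≤ ‖p‖`. For the others all factors `1/‖p‖² - 1/‖q +
np‖²` are positive, so `L_q = JC` with `J` skew-adjoint and `C` positive diagonal. Pairing `(z -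
L_q)x` with `Cx` bounds the resolvent off `iℝ`, uniformly in `q` because squared norms are integers
(`norm_resolvent_sliceL_le`). If `Γ ≠ 0`, the segments of the slices exhaust `iℝ`.

Hence off `iℝ` only finitely many slices contribute spectrum, all of it discrete, and the Riesz
projection of `L` is a finite sum of those of slices. This gives the essential spectrum of `L` and
the assertions on its eigenvalues. -/

theorem mul_resolvent {a : A} {z : ℂ} (h : z ∈ resolventSet ℂ a) :
    (algebraMap ℂ A z - a) * resolvent a z = 1 := Ring.mul_inverse_cancel _ h

theorem resolvent_mul {a : A} {z : ℂ} (h : z ∈ resolventSet ℂ a) :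
    resolvent a z * (algebraMap ℂ A z - a) = 1 := Ring.inverse_mul_cancel _ h

theorem resolvent_eq_of_mul_eq_one {a b : A} {z : ℂ} (h : (algebraMap ℂ A z - a) * b = 1)
    (h' : b * (algebraMap ℂ A z - a) = 1) : z ∈ resolventSet ℂ a ∧ resolvent a z = b := by
  have hz : z ∈ resolventSet ℂ a := ⟨⟨_, b, h, h'⟩, rfl⟩
  refine ⟨hz, ?_⟩
  calc resolvent a z = resolvent a z * ((algebraMap ℂ A z - a) * b) := by rw [h, mul_one]
    _ = b := by rw [← mul_assoc, resolvent_mul hz, one_mul]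

/-- The second resolvent identity. -/
theorem resolvent_add {a f : A} {z : ℂ} (h : z ∈ resolventSet ℂ a)
    (h' : z ∈ resolventSet ℂ (a + f)) :
    resolvent (a + f) z = resolvent a z + resolvent a z * f * resolvent (a + f) z := by
  have key : (algebraMap ℂ A z - a) * resolvent (a + f) z = 1 + f * resolvent (a + f) z := by
    rw [← mul_resolvent h']
    noncomm_ring
  calc resolvent (a + f) z
      = resolvent a z * (algebraMap ℂ A z - a) * resolvent (a + f) z := by
        rw [resolvent_mul h, one_mul]
    _ = _ := by rw [mul_assoc, key, mul_add, mul_one, mul_assoc]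

/-- The first resolvent identity. -/
theorem resolvent_eq_sub_smul {a : A} {z c : ℂ} (h : z ∈ resolventSet ℂ a)
    (hc : c ∈ resolventSet ℂ a) :
    resolvent a z = resolvent a c + (c - z) • (resolvent a c * resolvent a z) := by
  have key : (algebraMap ℂ A c - a) * resolvent a z = 1 + (c - z) • resolvent a z := by
    rw [← mul_resolvent h, sub_mul, sub_mul, ← Algebra.smul_def, ← Algebra.smul_def, sub_smul]
    abel
  calc resolvent a z
      = resolvent a c * (algebraMap ℂ A c - a) * resolvent a z := by
        rw [resolvent_mul hc, one_mul]
    _ = _ := by rw [mul_assoc, key, mul_add, mul_one, mul_smul_comm]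

/-- Iterates the first resolvent identity. The remainder is exact and carries the factor `(c - z) ^
m`, which later cancels a pole of order `m`. -/
theorem resolvent_taylor {a : A} {z c : ℂ} (h : z ∈ resolventSet ℂ a)
    (hc : c ∈ resolventSet ℂ a) (m : ℕ) :
    resolvent a z = ∑ j ∈ Finset.range m, (c - z) ^ j • resolvent a c ^ (j + 1)
      + (c - z) ^ m • (resolvent a c ^ m * resolvent a z) := by
  induction m with
  | zero => simp
  | succ m ih =>
    have h1 : resolvent a c ^ m * resolvent a z = resolvent a c ^ (m + 1)
        + (c - z) • (resolvent a c ^ (m + 1) * resolvent a z) := by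
      conv_lhs => rw [resolvent_eq_sub_smul h hc]
      rw [mul_add, mul_smul_comm, ← mul_assoc, ← pow_succ]
    rw [Finset.sum_range_succ, add_assoc]
    conv_lhs => rw [ih, h1]
    rw [smul_add, smul_smul, ← pow_succ]

end Resolvent

section Circle

variable {X Y : Type*} [NormedAddCommGroup X] [NormedSpace ℂ X] [CompleteSpace X]
  [NormedAddCommGroup Y] [NormedSpace ℂ Y] [CompleteSpace Y]

theorem circleIntegral_clm_comp (Φ : X →L[ℂ] Y) {f : ℂ → X} {c : ℂ} {r : ℝ}
    (hf : CircleIntegrable f c r) : (∮ z in C(c, r), Φ (f z)) = Φ (∮ z in C(c, r), f z) := by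
  have := ContinuousLinearMap.intervalIntegral_comp_comm Φ hf.out
  simp only [circleIntegral]
  rw [← this]
  simp

end Circle

/-! ### Finite rank operators and Riesz integrals. -/

section FiniteRank

variable {E : Type*} [NormedAddCommGroup E] [NormedSpace ℂ E]

/-- A bounded operator with finite-dimensional range. -/
def FiniteRank (T : E →L[ℂ] E) : Prop := FiniteDimensional ℂ (LinearMap.range (T : E →ₗ[ℂ] E))

theorem FiniteRank.of_range_le {T : E →L[ℂ] E} (W : Submodule ℂ E) [FiniteDimensional ℂ W]
    (h : ∀ x, T x ∈ W) : FiniteRank T :=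
  Submodule.finiteDimensional_of_le (S₂ := W) (by rintro _ ⟨x, rfl⟩; exact h x)

theorem FiniteRank.zero : FiniteRank (0 : E →L[ℂ] E) :=
  .of_range_le ⊥ (by simp)

theorem FiniteRank.add {S T : E →L[ℂ] E} (hS : FiniteRank S) (hT : FiniteRank T) :
    FiniteRank (S + T) := by
  unfold FiniteRank at hS hT
  exact .of_range_le (LinearMap.range (S : E →ₗ[ℂ] E) ⊔ LinearMap.range (T : E →ₗ[ℂ] E))
    fun x => Submodule.add_mem_sup ⟨x, rfl⟩ ⟨x, rfl⟩

theorem FiniteRank.mul_right {S : E →L[ℂ] E} (hS : FiniteRank S) (T : E →L[ℂ] E) :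
    FiniteRank (S * T) := by
  unfold FiniteRank at hS
  exact .of_range_le (LinearMap.range (S : E →ₗ[ℂ] E)) fun x => ⟨T x, rfl⟩

theorem FiniteRank.mul_left {S : E →L[ℂ] E} (hS : FiniteRank S) (T : E →L[ℂ] E) :
    FiniteRank (T * S) := by
  unfold FiniteRank at hS
  exact .of_range_le ((LinearMap.range (S : E →ₗ[ℂ] E)).map (T : E →ₗ[ℂ] E))
    fun x => ⟨S x, ⟨x, rfl⟩, rfl⟩

theorem FiniteRank.smul {S : E →L[ℂ] E} (hS : FiniteRank S) (a : ℂ) : FiniteRank (a • S) := by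
  unfold FiniteRank at hS
  exact .of_range_le (LinearMap.range (S : E →ₗ[ℂ] E)) fun x => Submodule.smul_mem _ a ⟨x, rfl⟩

theorem FiniteRank.sum {ι : Type*} (s : Finset ι) {S : ι → E →L[ℂ] E}
    (h : ∀ i ∈ s, FiniteRank (S i)) : FiniteRank (∑ i ∈ s, S i) := by
  classical
  induction s using Finset.induction_on with
  | empty => simpa using FiniteRank.zero
  | insert i s hi ih =>
    rw [Finset.sum_insert hi]
    exact (h i (by simp)).add (ih fun j hj => h j (by simp [hj]))

/-- Factoring through `ℂⁿ` turns invertibility of `z - S - F` into a question about an `n × n`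
determinant. -/
theorem exists_factorization {F : E →L[ℂ] E} (hF : FiniteRank F) :
    ∃ (n : ℕ) (ι : (Fin n → ℂ) →L[ℂ] E) (π : E →L[ℂ] (Fin n → ℂ)), F = ι ∘L π := by
  unfold FiniteRank at hF
  let e := (Module.finBasis ℂ (LinearMap.range (F : E →ₗ[ℂ] E))).equivFunL
  refine ⟨_, (Submodule.subtypeL _) ∘L e.symm.toContinuousLinearMap,
    e.toContinuousLinearMap ∘L (F.codRestrict (LinearMap.range (F : E →ₗ[ℂ] E)) fun x => ⟨x, rfl⟩), ?_⟩
  ext x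
  change F x = (e.symm (e ⟨F x, ⟨x, rfl⟩⟩) : E)
  rw [e.symm_apply_apply]

variable [CompleteSpace E]

theorem differentiableOn_resolvent {T : E →L[ℂ] E} {U : Set ℂ} (h : U ⊆ resolventSet ℂ T) :
    DifferentiableOn ℂ (resolvent T) U := fun _ hz =>
  (spectrum.hasDerivAt_resolvent_const_left (h hz)).differentiableAt.differentiableWithinAt

theorem rieszIntegral_eq_zero {T : E →L[ℂ] E} {c : ℂ} {r : ℝ} (hr : 0 ≤ r)
    (h : Metric.closedBall c r ⊆ resolventSet ℂ T) : rieszIntegral (resolvent T) c r = 0 := by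
  have hd := differentiableOn_resolvent h
  rw [rieszIntegral, Complex.circleIntegral_eq_zero_of_differentiable_on_off_countable hr
    Set.countable_empty hd.continuousOn, smul_zero]
  intro z hz
  exact (spectrum.hasDerivAt_resolvent_const_left
    (h (Metric.ball_subset_closedBall hz.1))).differentiableAt

/-- If the resolvent of a finite rank perturbation of `S` has at most a pole at a point of the
resolvent set of `S`, then the Riesz integral around this point has finite rank. -/
theorem finiteRank_rieszIntegral {S F : E →L[ℂ] E} (hF : FiniteRank F) {c : ℂ} {ρ : ℝ}
    (hS : Metric.ball c ρ ⊆ resolventSet ℂ S)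
    (hT : Metric.ball c ρ \ {c} ⊆ resolventSet ℂ (S + F)) {m : ℕ} {G : ℂ → E →L[ℂ] E}
    (hG : DifferentiableOn ℂ G (Metric.ball c ρ))
    (hGT : ∀ z ∈ Metric.ball c ρ \ {c}, G z = (z - c) ^ m • resolvent (S + F) z)
    {r : ℝ} (hr : 0 < r) (hrρ : r < ρ) : FiniteRank (rieszIntegral (resolvent (S + F)) c r) := by
  have hc : c ∈ resolventSet ℂ S := hS (Metric.mem_ball_self (hr.trans hrρ))
  have hsub : Metric.sphere c r ⊆ Metric.ball c ρ \ {c} := by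
    intro z hz
    refine ⟨Metric.sphere_subset_closedBall.trans (Metric.closedBall_subset_ball hrρ) hz, ?_⟩
    rintro rfl
    simp [hr.ne] at hz
  have hcT : ContinuousOn (resolvent (S + F)) (Metric.sphere c r) :=
    (differentiableOn_resolvent (hsub.trans hT)).continuousOn
  have hcS := differentiableOn_resolvent hS
  set R0 := resolvent S c
  -- Insert the Taylor expansion of `resolvent S z` into the second resolvent identity. `N` collects
  -- the terms holomorphic on the whole ball, which integrate to zero. Every remaining term starts
  -- with `R0 ^ (j + 1) * F`, independent of `z`, so its integral keeps finite rank.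
  set N : ℂ → E →L[ℂ] E := fun z =>
    resolvent S z + (-1 : ℂ) ^ m • (R0 ^ m * resolvent S z * F * G z) with hN
  have hNd : DifferentiableOn ℂ N (Metric.ball c ρ) :=
    hcS.fun_add ((((hcS.const_mul (R0 ^ m)).mul_const F).fun_mul hG).fun_const_smul _)
  have hNi : (∮ z in C(c, r), N z) = 0 := by
    apply DiffContOnCl.circleIntegral_eq_zero hr.le
    refine DifferentiableOn.diffContOnCl (hNd.mono ?_)
    exact Metric.closure_ball_subset_closedBall.trans (Metric.closedBall_subset_ball hrρ)
  set t : ℕ → ℂ → E →L[ℂ] E := fun j z => (c - z) ^ j • resolvent (S + F) z with ht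
  have htc : ∀ j, ContinuousOn (t j) (Metric.sphere c r) := fun j =>
    ((continuous_const.sub continuous_id).pow j).continuousOn.smul hcT
  have hexp : ∀ z ∈ Metric.sphere c r, resolvent (S + F) z =
      N z + ∑ j ∈ Finset.range m, R0 ^ (j + 1) * F * t j z := by
    intro z hz
    have hz' := hsub hz
    have hp : (c - z) ^ m • resolvent (S + F) z = (-1 : ℂ) ^ m • G z := by
      rw [hGT z hz', smul_smul, ← mul_pow]
      ring_nf
    have h1 := resolvent_add (hS hz'.1) (hT hz')
    have h2 := resolvent_taylor (hS hz'.1) hc m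
    have h3 : resolvent S z * F * resolvent (S + F) z =
        ∑ j ∈ Finset.range m, R0 ^ (j + 1) * F * t j z +
          (-1 : ℂ) ^ m • (R0 ^ m * resolvent S z * F * G z) := by
      conv_lhs => rw [h2]
      rw [add_mul, add_mul, Finset.sum_mul, Finset.sum_mul]
      congr 1
      · refine Finset.sum_congr rfl fun j _ => ?_
        rw [ht, smul_mul_assoc, smul_mul_assoc, mul_smul_comm]
      · rw [smul_mul_assoc, smul_mul_assoc, ← mul_smul_comm, hp, mul_smul_comm]
    rw [h1, h3, add_comm (∑ j ∈ Finset.range m, R0 ^ (j + 1) * F * t j z), ← add_assoc]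
  have hint : (∮ z in C(c, r), resolvent (S + F) z) =
      ∑ j ∈ Finset.range m, R0 ^ (j + 1) * F * ∮ z in C(c, r), t j z := by
    have hi : ∀ j ∈ Finset.range m,
        CircleIntegrable (fun z => R0 ^ (j + 1) * F * t j z) c r := fun j _ =>
      ContinuousOn.circleIntegrable hr.le (continuousOn_const.mul (htc j))
    rw [circleIntegral.integral_congr hr.le hexp, circleIntegral.integral_add, hNi, zero_add,
      circleIntegral.integral_fun_sum hi]
    · refine Finset.sum_congr rfl fun j _ => ?_
      exact circleIntegral_clm_comp (ContinuousLinearMap.mul ℂ (E →L[ℂ] E) (R0 ^ (j + 1) * F))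
        (ContinuousOn.circleIntegrable hr.le (htc j))
    · exact ContinuousOn.circleIntegrable hr.le
        (hNd.continuousOn.mono fun z hz => (hsub hz).1)
    · exact ContinuousOn.circleIntegrable hr.le
        (continuousOn_finsetSum _ fun j _ => continuousOn_const.mul (htc j))
  rw [rieszIntegral, hint]
  exact (FiniteRank.sum _ fun j _ => (hF.mul_left _).mul_right _).smul _

end FiniteRank

/-! ### Holomorphy of determinants and adjugates. -/

section Det

open Matrix

theorem differentiableOn_det {n : ℕ} {M : ℂ → Matrix (Fin n) (Fin n) ℂ} {U : Set ℂ}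
    (h : ∀ i j, DifferentiableOn ℂ (fun z => M z i j) U) :
    DifferentiableOn ℂ (fun z => (M z).det) U := by
  simp only [det_apply']
  exact DifferentiableOn.fun_sum fun σ _ => DifferentiableOn.const_mul
    (DifferentiableOn.fun_finsetProd fun i _ => h _ _) _

theorem differentiableOn_adjugate {n : ℕ} {M : ℂ → Matrix (Fin n) (Fin n) ℂ} {U : Set ℂ}
    (h : ∀ i j, DifferentiableOn ℂ (fun z => M z i j) U) (i j : Fin n) :
    DifferentiableOn ℂ (fun z => (M z).adjugate i j) U := by
  simp only [adjugate_apply]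
  refine differentiableOn_det fun k l => ?_
  by_cases hk : k = j
  · subst hk
    simp only [updateRow_self]
    exact differentiableOn_const _
  · simp only [updateRow_ne hk]
    exact h k l

end Det

/-! ### Analytic Fredholm theory for finite rank perturbations. -/

section Fredholm

open Matrix

variable {E : Type*} [NormedAddCommGroup E] [NormedSpace ℂ E]

/-- The operator `ι A π` for a matrix `A`. -/
def sandwich {n : ℕ} (ι : (Fin n → ℂ) →L[ℂ] E) (π : E →L[ℂ] (Fin n → ℂ)) :
    Matrix (Fin n) (Fin n) ℂ →ₗ[ℂ] (E →L[ℂ] E) where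
  toFun A := ι ∘L (Matrix.toLin' A).toContinuousLinearMap ∘L π
  map_add' A B := by ext x; simp
  map_smul' a A := by ext x; simp

/-- The matrix of `π R ι`. -/
def compressMatrix {n : ℕ} (ι : (Fin n → ℂ) →L[ℂ] E) (π : E →L[ℂ] (Fin n → ℂ))
    (R : E →L[ℂ] E) : Matrix (Fin n) (Fin n) ℂ :=
  LinearMap.toMatrix' ((π ∘L R ∘L ι : (Fin n → ℂ) →L[ℂ] (Fin n → ℂ)) : (Fin n → ℂ) →ₗ[ℂ] _)

variable {n : ℕ} (ι : (Fin n → ℂ) →L[ℂ] E) (π : E →L[ℂ] (Fin n → ℂ))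

theorem sandwich_one : sandwich ι π 1 = ι ∘L π := by
  ext x
  simp [sandwich]

theorem sandwich_mul_mul (A B : Matrix (Fin n) (Fin n) ℂ) (R : E →L[ℂ] E) :
    sandwich ι π A * R * sandwich ι π B = sandwich ι π (A * compressMatrix ι π R * B) := by
  ext x
  simp only [sandwich, compressMatrix, LinearMap.coe_mk, AddHom.coe_mk,
    ContinuousLinearMap.comp_apply,
    LinearMap.coe_toContinuousLinearMap', Matrix.toLin'_mul, LinearMap.comp_apply,
    Matrix.toLin'_toMatrix', ContinuousLinearMap.coe_coe]
  rfl

theorem differentiableOn_sandwich {M : ℂ → Matrix (Fin n) (Fin n) ℂ} {U : Set ℂ}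
    (h : ∀ i j, DifferentiableOn ℂ (fun z => M z i j) U) :
    DifferentiableOn ℂ (fun z => sandwich ι π (M z)) U := by
  have : ∀ z, sandwich ι π (M z) =
      ∑ i, ∑ j, M z i j • sandwich ι π (Matrix.single i j 1) := by
    intro z
    conv_lhs => rw [Matrix.matrix_eq_sum_single (M z)]
    simp only [map_sum, ← map_smul, Matrix.smul_single, smul_eq_mul, mul_one]
  simp only [this]
  exact DifferentiableOn.fun_sum fun i _ => DifferentiableOn.fun_sum fun j _ =>
    (h i j).smul_const _

theorem differentiableOn_compressMatrix {R : ℂ → E →L[ℂ] E} {U : Set ℂ}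
    (h : DifferentiableOn ℂ R U) (i j : Fin n) :
    DifferentiableOn ℂ (fun z => compressMatrix ι π (R z) i j) U := by
  let Φ : (E →L[ℂ] E) →L[ℂ] ℂ := (ContinuousLinearMap.proj i ∘L π) ∘L
    ContinuousLinearMap.apply ℂ E (ι (Pi.single j 1))
  have : ∀ z, compressMatrix ι π (R z) i j = Φ (R z) := by
    intro z
    simp [compressMatrix, Φ, LinearMap.toMatrix'_apply]
  simp only [this]
  exact Φ.differentiable.comp_differentiableOn h

/-- The Woodbury formula `R + Rι(1 - πRι)⁻¹πR`. The matrix inverse is written as adjugate over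
determinant, so the scalar determinant is the only source of singularities. -/
theorem resolvent_add_sandwich {S : E →L[ℂ] E} {z : ℂ} (hz : z ∈ resolventSet ℂ S)
    (hd : (1 - compressMatrix ι π (resolvent S z)).det ≠ 0) :
    z ∈ resolventSet ℂ (S + ι ∘L π) ∧ resolvent (S + ι ∘L π) z = resolvent S z +
      (1 - compressMatrix ι π (resolvent S z)).det⁻¹ • (resolvent S z *
        sandwich ι π (1 - compressMatrix ι π (resolvent S z)).adjugate * resolvent S z) := by
  set R := resolvent S z with hR
  set B := compressMatrix ι π R with hB
  set N := (1 - B).det⁻¹ • (1 - B).adjugate with hN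
  have h1 : N - B * N = 1 := by
    have : (1 - B) * N = 1 := by
      rw [hN, Matrix.mul_smul, Matrix.mul_adjugate, smul_smul, inv_mul_cancel₀ hd, one_smul]
    rw [← this]; noncomm_ring
  have h2 : N - N * B = 1 := by
    have : N * (1 - B) = 1 := by
      rw [hN, Matrix.smul_mul, Matrix.adjugate_mul, smul_smul, inv_mul_cancel₀ hd, one_smul]
    rw [← this]; noncomm_ring
  have hF := sandwich_one ι π
  have f1 : sandwich ι π 1 * R * sandwich ι π N = sandwich ι π N - sandwich ι π 1 := by
    rw [sandwich_mul_mul, one_mul, ← map_sub, ← hB, ← h1]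
    congr 1; abel
  have f2 : sandwich ι π N * R * sandwich ι π 1 = sandwich ι π N - sandwich ι π 1 := by
    rw [sandwich_mul_mul, mul_one, ← map_sub, ← hB, ← h2]
    congr 1; abel
  have e : (1 - B).det⁻¹ • (R * sandwich ι π (1 - B).adjugate * R) =
      R * sandwich ι π N * R := by
    rw [hN, map_smul, mul_smul_comm, smul_mul_assoc]
  rw [e, ← hF]
  have a1 : (algebraMap ℂ (E →L[ℂ] E) z - S) * R = 1 := mul_resolvent hz
  have a2 : R * (algebraMap ℂ (E →L[ℂ] E) z - S) = 1 := resolvent_mul hz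
  apply resolvent_eq_of_mul_eq_one
  · calc (algebraMap ℂ (E →L[ℂ] E) z - (S + sandwich ι π 1)) * (R + R * sandwich ι π N * R)
        = (algebraMap ℂ (E →L[ℂ] E) z - S) * R * (1 + sandwich ι π N * R) - sandwich ι π 1 * R
          - sandwich ι π 1 * R * sandwich ι π N * R := by noncomm_ring
      _ = 1 := by rw [a1, f1]; noncomm_ring
  · calc (R + R * sandwich ι π N * R) * (algebraMap ℂ (E →L[ℂ] E) z - (S + sandwich ι π 1))
        = (1 + R * sandwich ι π N) * (R * (algebraMap ℂ (E →L[ℂ] E) z - S)) - R * sandwich ι π 1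
          - R * (sandwich ι π N * R * sandwich ι π 1) := by noncomm_ring
      _ = 1 := by rw [a2, f2]; noncomm_ring

/-- Compressing the second resolvent identity by `π` and `ι` exhibits `1 + πTι` as an inverse of `1
- πRι`, where `T` is the perturbed resolvent. -/
theorem det_compressMatrix_ne_zero {S : E →L[ℂ] E} {z : ℂ} (hz : z ∈ resolventSet ℂ S)
    (hz' : z ∈ resolventSet ℂ (S + ι ∘L π)) :
    (1 - compressMatrix ι π (resolvent S z)).det ≠ 0 := by
  have key : (1 - compressMatrix ι π (resolvent S z)) *
      (1 + compressMatrix ι π (resolvent (S + ι ∘L π) z)) = 1 := by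
    have h := resolvent_add hz hz'
    set R := resolvent S z
    set T := resolvent (S + ι ∘L π) z
    have h1 : compressMatrix ι π T =
        compressMatrix ι π R + compressMatrix ι π R * compressMatrix ι π T := by
      simp only [compressMatrix, ← LinearMap.toMatrix'_mul, ← map_add]
      congr 1
      ext1 x
      have hx := congrArg π (DFunLike.congr_fun h (ι (Pi.single x 1)))
      ext
      simpa using congrFun hx _
    calc (1 - compressMatrix ι π R) * (1 + compressMatrix ι π T)
        = 1 + (compressMatrix ι π T -
          (compressMatrix ι π R + compressMatrix ι π R * compressMatrix ι π T)) := by noncomm_ring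
      _ = 1 := by rw [← h1, sub_self, add_zero]
  intro h0
  have := congrArg Matrix.det key
  rw [Matrix.det_mul, h0, zero_mul, Matrix.det_one] at this
  exact zero_ne_one this

variable [CompleteSpace E]

/-- Analytic Fredholm theory for a finite rank perturbation: the spectrum is discrete in any
connected part of the resolvent set of the unperturbed operator that contains a point of the
resolvent set of the perturbed one. -/
theorem exists_finiteRank_rieszIntegral {S F : E →L[ℂ] E} (hF : FiniteRank F) {U : Set ℂ}
    (hU : IsOpen U) (hUc : IsPreconnected U) (hS : U ⊆ resolventSet ℂ S)
    (hne : ∃ z ∈ U, z ∈ resolventSet ℂ (S + F)) {c : ℂ} (hc : c ∈ U) :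
    ∃ r₀ > 0, ∀ r, 0 < r → r < r₀ → Metric.closedBall c r ∩ spectrum ℂ (S + F) ⊆ {c} ∧
      FiniteRank (rieszIntegral (resolvent (S + F)) c r) := by
  obtain ⟨n, ι, π, rfl⟩ := exists_factorization hF
  have hR := differentiableOn_resolvent hS
  set M : ℂ → Matrix (Fin n) (Fin n) ℂ := fun z => 1 - compressMatrix ι π (resolvent S z) with hM
  have hMd : ∀ i j, DifferentiableOn ℂ (fun z => M z i j) U := fun i j => by
    simp only [hM, Matrix.sub_apply]
    exact (differentiableOn_const _).sub (differentiableOn_compressMatrix ι π hR i j)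
  have hdet : AnalyticOnNhd ℂ (fun z => (M z).det) U :=
    (differentiableOn_det hMd).analyticOnNhd hU
  -- By the identity theorem on the preconnected set `U`, vanishing near `c` would force vanishing
  -- at the given regular point of `S + F`.
  have hnz : ¬ ∀ᶠ z in nhds c, (M z).det = 0 := by
    intro h0
    obtain ⟨w, hwU, hw⟩ := hne
    exact det_compressMatrix_ne_zero ι π (hS hwU) hw
      (hdet.eqOn_zero_of_preconnected_of_eventuallyEq_zero hUc hc h0 hwU)
  obtain ⟨m, g, hg, hgc, hgM⟩ := (hdet c hc).exists_eventuallyEq_pow_smul_nonzero_iff.2 hnz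
  have hev : ∀ᶠ z in nhds c, (M z).det = (z - c) ^ m • g z ∧ g z ≠ 0 ∧
      DifferentiableAt ℂ g z ∧ z ∈ U := by
    filter_upwards [hgM, hg.continuousAt.eventually_ne hgc, hg.eventually_analyticAt,
      hU.mem_nhds hc] with z h1 h2 h3 h4 using ⟨h1, h2, h3.differentiableAt, h4⟩
  obtain ⟨ρ, hρ, hball⟩ := Metric.eventually_nhds_iff_ball.1 hev
  have hbU : Metric.ball c ρ ⊆ U := fun z hz => (hball z hz).2.2.2
  have hdet' : ∀ z ∈ Metric.ball c ρ \ {c}, (M z).det ≠ 0 := by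
    intro z hz
    rw [(hball z hz.1).1]
    exact smul_ne_zero (pow_ne_zero _ (sub_ne_zero.2 hz.2)) (hball z hz.1).2.1
  have hT : Metric.ball c ρ \ {c} ⊆ resolventSet ℂ (S + ι ∘L π) := fun z hz =>
    (resolvent_add_sandwich ι π (hS (hbU hz.1)) (hdet' z hz)).1
  refine ⟨ρ, hρ, fun r hr hrρ => ⟨?_, ?_⟩⟩
  · rintro z ⟨hz, hzs⟩
    by_contra hne
    exact hzs (hT ⟨Metric.closedBall_subset_ball hrρ hz, hne⟩)
  -- Since `det = (z - c) ^ m • g` with `g` zero-free on the ball, multiplying the Woodbury formula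
  -- by `(z - c) ^ m` replaces `det⁻¹` by `g⁻¹`; the result is holomorphic at `c` too.
  · refine finiteRank_rieszIntegral hF (hbU.trans hS) hT (m := m)
      (G := fun z => (z - c) ^ m • resolvent S z +
        (g z)⁻¹ • (resolvent S z * sandwich ι π (M z).adjugate * resolvent S z)) ?_ ?_ hr hrρ
    · have hRb := hR.mono hbU
      have hgd : DifferentiableOn ℂ g (Metric.ball c ρ) := fun z hz =>
        (hball z hz).2.2.1.differentiableWithinAt
      refine DifferentiableOn.fun_add (DifferentiableOn.fun_smul (by fun_prop) hRb) ?_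
      refine DifferentiableOn.fun_smul (hgd.fun_inv fun z hz => (hball z hz).2.1) ?_
      exact (hRb.fun_mul (differentiableOn_sandwich ι π
        (differentiableOn_adjugate fun i j => (hMd i j).mono hbU))).fun_mul hRb
    · intro z hz
      rw [(resolvent_add_sandwich ι π (hS (hbU hz.1)) (hdet' z hz)).2, smul_add, smul_smul]
      congr 2
      change _ = (z - c) ^ m * (M z).det⁻¹
      rw [(hball z hz.1).1, smul_eq_mul, mul_inv, ← mul_assoc,
        mul_inv_cancel₀ (pow_ne_zero _ (sub_ne_zero.2 hz.2)), one_mul]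

end Fredholm

/-! ### Resolvent sets from the numerical range. -/

section NumericalRange

variable {E : Type*} [NormedAddCommGroup E] [InnerProductSpace ℂ E] [CompleteSpace E]

/-- The hypothesis makes `w(c - S)` coercive with constant `(w * c).re - b`, so Lax–Milgram applies.
-/
theorem mem_resolventSet_of_re_inner_le {S : E →L[ℂ] E} {w c : ℂ} (hw : ‖w‖ = 1) {b : ℝ}
    (hS : ∀ x, (w * inner ℂ x (S x)).re ≤ b * ‖x‖ ^ 2) (hc : b < (w * c).re) :
    c ∈ resolventSet ℂ S := by
  rw [spectrum.mem_resolventSet_iff]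
  refine ContinuousLinearMap.isUnit_of_forall_le_norm_inner_map _
    (c := Real.toNNReal ((w * c).re - b)) (Real.toNNReal_pos.2 (by linarith)) fun x => ?_
  rw [← inner_conj_symm, RCLike.norm_conj, Real.coe_toNNReal _ (by linarith)]
  have h1 : inner ℂ x ((algebraMap ℂ (E →L[ℂ] E) c - S) x) =
      c * ((‖x‖ ^ 2 : ℝ) : ℂ) - inner ℂ x (S x) := by
    rw [sub_apply, inner_sub_right, ContinuousLinearMap.algebraMap_apply,
      inner_smul_right, inner_self_eq_norm_sq_to_K]
    push_cast
    rfl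
  calc ‖x‖ ^ 2 * ((w * c).re - b)
      ≤ (w * (c * ((‖x‖ ^ 2 : ℝ) : ℂ) - inner ℂ x (S x))).re := by
        rw [mul_sub w, Complex.sub_re, ← mul_assoc, Complex.re_mul_ofReal]
        linarith [hS x]
    _ ≤ ‖w * (c * ((‖x‖ ^ 2 : ℝ) : ℂ) - inner ℂ x (S x))‖ := Complex.re_le_norm _
    _ = ‖inner ℂ x ((algebraMap ℂ (E →L[ℂ] E) c - S) x)‖ := by
        rw [norm_mul, hw, one_mul, h1]

/-- Points outside a half plane containing the numerical range of `L₀` are at most discrete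
spectrum of every limit of finite rank perturbations of `L₀`. -/
theorem exists_finiteRank_rieszIntegral_of_re_inner_le {L₀ T : E →L[ℂ] E} {w c : ℂ}
    (hw : ‖w‖ = 1) {b : ℝ} (hL₀ : ∀ x, (w * inner ℂ x (L₀ x)).re ≤ b * ‖x‖ ^ 2)
    (hT : ∀ ε > 0, ∃ K F : E →L[ℂ] E, T = L₀ + K + F ∧ ‖K‖ ≤ ε ∧ FiniteRank F)
    (hc : b < (w * c).re) :
    ∃ r₀ > 0, ∀ r, 0 < r → r < r₀ → Metric.closedBall c r ∩ spectrum ℂ T ⊆ {c} ∧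
      FiniteRank (rieszIntegral (resolvent T) c r) := by
  obtain ⟨ε, hε, hbε⟩ : ∃ ε > 0, b + ε < (w * c).re := ⟨((w * c).re - b) / 2, by linarith,
    by linarith⟩
  obtain ⟨K, F, rfl, hK, hF⟩ := hT ε hε
  have hlin : IsLinearMap ℝ fun z : ℂ => (w * z).re :=
    ⟨fun x y => by simp [mul_add], fun a x => by simp; ring⟩
  refine exists_finiteRank_rieszIntegral hF (U := {z | b + ε < (w * z).re})
    (isOpen_lt (by fun_prop) (by fun_prop)) (convex_halfSpace_gt hlin _).isPreconnected ?_ ?_ hbε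
  · intro z hz
    refine mem_resolventSet_of_re_inner_le hw (fun x => ?_) hz
    rw [add_apply, inner_add_right, mul_add, Complex.add_re, add_mul]
    refine add_le_add (hL₀ x) ((Complex.re_le_norm _).trans ?_)
    rw [norm_mul, hw, one_mul]
    calc ‖inner ℂ x (K x)‖ ≤ ‖x‖ * ‖K x‖ := norm_inner_le_norm _ _
      _ ≤ ‖x‖ * (ε * ‖x‖) := by gcongr; exact K.le_of_opNorm_le hK x
      _ = ε * ‖x‖ ^ 2 := by ring
  -- The half plane is unbounded in the direction `conj w`, so it contains a point beyond the norm
  -- of the whole operator. This is the regular point that the Fredholm argument needs.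
  · set t : ℝ := max (b + ε) (‖L₀ + K + F‖ * ‖(1 : E →L[ℂ] E)‖) + 1 with ht
    have ht0 : 0 < t := by
      have : 0 ≤ ‖L₀ + K + F‖ * ‖(1 : E →L[ℂ] E)‖ := by positivity
      have := this.trans (le_max_right (b + ε) _)
      linarith
    refine ⟨t * conj w, ?_, ?_⟩
    · have : w * (t * conj w) = (t : ℂ) := by
        rw [mul_left_comm, Complex.mul_conj, Complex.normSq_eq_norm_sq, hw]; simp
      simp only [Set.mem_ofPred_eq, this, Complex.ofReal_re]
      linarith [le_max_left (b + ε) (‖L₀ + K + F‖ * ‖(1 : E →L[ℂ] E)‖)]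
    · apply spectrum.mem_resolventSet_of_norm_lt_mul
      rw [norm_mul, RCLike.norm_conj, hw, mul_one, Complex.norm_real, Real.norm_eq_abs,
        abs_of_pos ht0]
      linarith [le_max_right (b + ε) (‖L₀ + K + F‖ * ‖(1 : E →L[ℂ] E)‖)]

/-- Excludes approximate eigenvectors at regular points; used for plane waves and for genuine
eigenvectors. -/
theorem exists_norm_le_of_mem_resolventSet {F : Type*} [NormedAddCommGroup F] [NormedSpace ℂ F]
    {T : F →L[ℂ] F} {z : ℂ} (hz : z ∈ resolventSet ℂ T) :
    ∃ C > 0, ∀ x, ‖x‖ ≤ C * ‖T x - z • x‖ := by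
  refine ⟨‖resolvent T z‖ + 1, by positivity, fun x => ?_⟩
  have h := DFunLike.congr_fun (resolvent_mul hz) x
  have h' : resolvent T z (z • x - T x) = x := h
  calc ‖x‖ = ‖resolvent T z (z • x - T x)‖ := by rw [h']
    _ ≤ ‖resolvent T z‖ * ‖z • x - T x‖ := ContinuousLinearMap.le_opNorm _ _
    _ ≤ (‖resolvent T z‖ + 1) * ‖T x - z • x‖ := by
      rw [norm_sub_rev]; gcongr; linarith

end NumericalRange

/-! ### Operators `VD - V*D*` with convergent coefficients. -/

section Jacobi

local notation "H" => ℓ²(ℤ, ℂ)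

theorem shiftV_apply (x : H) (n : ℤ) : shiftV x n = x (n - 1) := rfl

theorem norm_shiftV_apply (x : H) : ‖shiftV x‖ = ‖x‖ := by
  rw [lp.norm_eq_tsum_rpow (by simp), lp.norm_eq_tsum_rpow (by simp)]
  refine congrArg (fun t : ℝ => t ^ (1 / (2 : ENNReal).toReal)) ?_
  exact (Equiv.subRight (1 : ℤ)).tsum_eq (fun n => ‖x n‖ ^ (2 : ENNReal).toReal)

theorem adjoint_apply_eq_inner (T : H →L[ℂ] H) (x : H) (n : ℤ) :
    ContinuousLinearMap.adjoint T x n = inner ℂ (T (lp.single 2 n (1 : ℂ))) x := by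
  rw [← ContinuousLinearMap.adjoint_inner_right, lp.inner_single_left]
  simp

theorem shiftV_single (n : ℤ) (a : ℂ) :
    shiftV (lp.single 2 n a) = lp.single 2 (n + 1) a := by
  ext m
  simp only [shiftV_apply, lp.coeFn_single, Pi.single_apply, sub_eq_iff_eq_add]

theorem adjoint_shiftV_apply (x : H) (n : ℤ) :
    ContinuousLinearMap.adjoint shiftV x n = x (n + 1) := by
  rw [adjoint_apply_eq_inner, shiftV_single, lp.inner_single_left]
  simp

theorem norm_adjoint_shiftV_apply_le (x : H) :
    ‖ContinuousLinearMap.adjoint shiftV x‖ ≤ ‖x‖ := by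
  have h : ‖ContinuousLinearMap.adjoint shiftV‖ ≤ 1 := by
    rw [LinearIsometryEquiv.norm_map]
    exact ContinuousLinearMap.opNorm_le_bound _ zero_le_one fun y => by
      rw [norm_shiftV_apply, one_mul]
  simpa using ContinuousLinearMap.le_of_opNorm_le _ h x

/-- `D` is the multiplication operator by the sequence `d`. -/
def IsDiag (D : H →L[ℂ] H) (d : ℤ → ℂ) : Prop := ∀ x n, D x n = d n * x n

theorem IsDiag.adjoint {D : H →L[ℂ] H} {d : ℤ → ℂ} (h : IsDiag D d) :
    IsDiag (ContinuousLinearMap.adjoint D) fun n => conj (d n) := by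
  intro x n
  have : D (lp.single 2 n (1 : ℂ)) = lp.single 2 n (d n) := by
    ext m
    rw [h]
    by_cases hm : m = n
    · subst hm; simp
    · simp [hm]
  rw [adjoint_apply_eq_inner, this, lp.inner_single_left]
  simp [mul_comm]

theorem norm_le_mul_of_forall {ι : Type*} {x y : ℓ²(ι, ℂ)} {K : ℝ} (hK : 0 ≤ K)
    (h : ∀ n, ‖y n‖ ≤ K * ‖x n‖) : ‖y‖ ≤ K * ‖x‖ := by
  have : ‖(K : ℂ) • x‖ = K * ‖x‖ := by
    rw [norm_smul, Complex.norm_real, Real.norm_eq_abs, abs_of_nonneg hK]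
  rw [← this]
  refine lp.norm_mono (by simp) fun n => ?_
  rw [lp.coeFn_smul, Pi.smul_apply, norm_smul, Complex.norm_real, Real.norm_eq_abs,
    abs_of_nonneg hK]
  exact h n

theorem IsDiag.norm_le {D : H →L[ℂ] H} {d : ℤ → ℂ} (h : IsDiag D d) {K : ℝ} (hK : 0 ≤ K)
    (hd : ∀ n, ‖d n‖ ≤ K) : ‖D‖ ≤ K :=
  ContinuousLinearMap.opNorm_le_bound _ hK fun x => norm_le_mul_of_forall hK fun n => by
    rw [h, norm_mul]; gcongr; exact hd n

theorem IsDiag.finiteRank {D : H →L[ℂ] H} {d : ℤ → ℂ} (h : IsDiag D d) (s : Finset ℤ)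
    (hd : ∀ n ∉ s, d n = 0) : FiniteRank D := by
  have : FiniteDimensional ℂ
      (Submodule.span ℂ ((fun n => (lp.single 2 n (1 : ℂ) : H)) '' (s : Set ℤ))) :=
    FiniteDimensional.span_of_finite ℂ (s.finite_toSet.image _)
  refine .of_range_le (Submodule.span ℂ ((fun n => (lp.single 2 n (1 : ℂ) : H)) '' (s : Set ℤ)))
    fun x => ?_
  have : D x = ∑ n ∈ s, (d n * x n) • (lp.single 2 n (1 : ℂ) : H) := by
    ext m
    rw [h, lp.coeFn_sum, Finset.sum_apply]
    simp only [lp.coeFn_smul, Pi.smul_apply, lp.coeFn_single, Pi.single_apply, smul_eq_mul,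
      mul_ite, mul_one, mul_zero, Finset.sum_ite_eq]
    split_ifs with hm
    · rfl
    · rw [hd m hm, zero_mul]
  rw [this]
  exact Submodule.sum_mem _ fun n hn => Submodule.smul_mem _ _
    (Submodule.subset_span ⟨n, hn, rfl⟩)

/-- The projection to the `n`-th coordinate. -/
def coordProj (n : ℤ) : H →L[ℂ] H :=
  lp.singleContinuousLinearMap ℂ (fun _ : ℤ => ℂ) 2 n ∘L lp.evalCLM ℂ (fun _ : ℤ => ℂ) 2 n

theorem coordProj_apply (n : ℤ) (x : H) (m : ℤ) :
    coordProj n x m = if m = n then x n else 0 := by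
  change lp.single (E := fun _ : ℤ => ℂ) 2 n (x n) m = _
  rw [lp.coeFn_single, Pi.single_apply]

/-- Only finitely many entries lie at distance at least `ε` from `b`, and `D₂` carries exactly
those. The adjoint of `D₂` is included because `jacobi` involves both. -/
theorem IsDiag.exists_decomposition {D : H →L[ℂ] H} {d : ℤ → ℂ} (h : IsDiag D d) {b : ℂ}
    (hd : Filter.Tendsto d Filter.cofinite (nhds b)) {ε : ℝ} (hε : 0 < ε) :
    ∃ D₁ D₂ : H →L[ℂ] H, D = b • (1 : H →L[ℂ] H) + D₁ + D₂ ∧ ‖D₁‖ ≤ ε ∧ FiniteRank D₂ ∧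
      FiniteRank (ContinuousLinearMap.adjoint D₂) := by
  have hfin : {n | ¬ dist (d n) b < ε}.Finite := Filter.eventually_cofinite.1
    (Metric.tendsto_nhds.1 hd ε hε)
  set s := hfin.toFinset with hs
  set D₂ : H →L[ℂ] H := ∑ n ∈ s, (d n - b) • coordProj n with hD₂
  have h2 : IsDiag D₂ fun n => if n ∈ s then d n - b else 0 := by
    intro x m
    rw [hD₂, sum_apply, lp.coeFn_sum, Finset.sum_apply]
    simp only [smul_apply, lp.coeFn_smul, Pi.smul_apply, coordProj_apply,
      smul_eq_mul, mul_ite, mul_zero, Finset.sum_ite_eq]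
    split_ifs <;> simp
  refine ⟨D - b • (1 : H →L[ℂ] H) - D₂, D₂, by abel, ?_, ?_, ?_⟩
  · have h1 : IsDiag (D - b • (1 : H →L[ℂ] H) - D₂) fun n => if n ∈ s then 0 else d n - b := by
      intro x m
      have : (D - b • (1 : H →L[ℂ] H) - D₂) x m = D x m - b * x m - D₂ x m := rfl
      rw [this, h, h2]
      dsimp only
      split_ifs <;> ring
    refine h1.norm_le hε.le fun n => ?_
    split_ifs with hn
    · simpa using hε.le
    · simp only [hs, Set.Finite.mem_toFinset, Set.mem_ofPred_eq, not_not] at hn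
      rw [← dist_eq_norm]
      exact hn.le
  · exact h2.finiteRank s fun n hn => by simp [hn]
  · exact h2.adjoint.finiteRank s fun n hn => by simp [hn]

/-- The operator `V D - V* D*`. -/
def jacobi (D : H →L[ℂ] H) : H →L[ℂ] H :=
  shiftV ∘L D - ContinuousLinearMap.adjoint shiftV ∘L ContinuousLinearMap.adjoint D

theorem jacobi_add (D D' : H →L[ℂ] H) : jacobi (D + D') = jacobi D + jacobi D' := by
  simp only [jacobi, map_add, ContinuousLinearMap.comp_add]
  abel

theorem norm_jacobi_apply_le (D : H →L[ℂ] H) (x : H) :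
    ‖jacobi D x‖ ≤ ‖D x‖ + ‖ContinuousLinearMap.adjoint D x‖ := by
  refine (norm_sub_le _ _).trans (add_le_add (norm_shiftV_apply _).le
    (norm_adjoint_shiftV_apply_le _))

theorem norm_jacobi_le (D : H →L[ℂ] H) : ‖jacobi D‖ ≤ 2 * ‖D‖ :=
  ContinuousLinearMap.opNorm_le_bound _ (by positivity) fun x => by
    have h1 := D.le_opNorm x
    have h2 := (ContinuousLinearMap.adjoint D).le_opNorm x
    rw [LinearIsometryEquiv.norm_map] at h2
    linarith [norm_jacobi_apply_le D x]

theorem FiniteRank.jacobi {D : H →L[ℂ] H} (h : FiniteRank D)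
    (h' : FiniteRank (ContinuousLinearMap.adjoint D)) : FiniteRank (jacobi D) := by
  have : LinEuler.jacobi D = shiftV * D +
      (-1 : ℂ) • (ContinuousLinearMap.adjoint shiftV * ContinuousLinearMap.adjoint D) := by
    rw [neg_one_smul, ← sub_eq_add_neg]; rfl
  rw [this]
  exact (h.mul_left _).add ((h'.mul_left _).smul _)

/-- The operator is `bV` minus its adjoint, hence skew-adjoint. -/
theorem re_inner_jacobi_smul_one (b : ℂ) (x : H) :
    (inner ℂ x (jacobi (b • 1) x)).re = 0 := by
  have h : jacobi (b • 1) x = b • shiftV x - conj b • ContinuousLinearMap.adjoint shiftV x := by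
    have : ContinuousLinearMap.adjoint (b • (1 : H →L[ℂ] H)) = conj b • 1 := by
      rw [map_smulₛₗ]
      congr 1
      exact ContinuousLinearMap.adjoint_id
    simp [jacobi, this]
  rw [h, inner_sub_right, inner_smul_right, inner_smul_right,
    ContinuousLinearMap.adjoint_inner_right, ← inner_conj_symm (shiftV x) x, ← map_mul,
    Complex.sub_re, Complex.conj_re, sub_self]

/-- The segment `i [-2|b|, 2|b|]`. -/
def imagSegment (b : ℂ) : Set ℂ :=
  {z : ℂ | ∃ t ∈ Set.Icc (-(2 * ‖b‖)) (2 * ‖b‖), z = Complex.I * (t : ℂ)}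

/-- By skew-adjointness and the norm bound `2‖b‖`, the numerical range on unit vectors lies in the
segment. Four half planes (left, right, above, below) cover the complement of the segment. -/
theorem exists_halfPlane {b z : ℂ} (hz : z ∉ imagSegment b) :
    ∃ w : ℂ, ∃ a : ℝ, ‖w‖ = 1 ∧ (∀ x, (w * inner ℂ x (jacobi (b • 1) x)).re ≤ a * ‖x‖ ^ 2) ∧
      a < (w * z).re := by
  have him : ∀ x : H, |(inner ℂ x (jacobi (b • 1) x)).im| ≤ 2 * ‖b‖ * ‖x‖ ^ 2 := fun x => by
    refine (Complex.abs_im_le_norm _).trans ((norm_inner_le_norm _ _).trans ?_)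
    have h1 := (jacobi (b • 1)).le_of_opNorm_le (norm_jacobi_le _) x
    have h2 : ‖b • (1 : H →L[ℂ] H)‖ ≤ ‖b‖ := by
      rw [norm_smul]
      exact mul_le_of_le_one_right (norm_nonneg _) ContinuousLinearMap.norm_id_le
    calc ‖x‖ * ‖jacobi (b • 1) x‖ ≤ ‖x‖ * (2 * ‖b‖ * ‖x‖) := by
          gcongr; exact h1.trans (by gcongr)
      _ = _ := by ring
  rcases lt_trichotomy z.re 0 with h | h | h
  · refine ⟨-1, 0, by simp, fun x => ?_, by simpa using h⟩
    simp [re_inner_jacobi_smul_one]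
  · have : 2 * ‖b‖ < |z.im| := by
      by_contra hle
      exact hz ⟨z.im, abs_le.1 (not_lt.1 hle), by apply Complex.ext <;> simp [h]⟩
    rcases lt_abs.1 this with h' | h'
    · refine ⟨-Complex.I, 2 * ‖b‖, by simp, fun x => ?_, by simpa using h'⟩
      simpa using (le_abs_self _).trans (him x)
    · refine ⟨Complex.I, 2 * ‖b‖, by simp, fun x => ?_, by simpa using h'⟩
      simpa using (neg_le_abs _).trans (him x)
  · refine ⟨1, 0, by simp, fun x => ?_, by simpa using h⟩
    simp [re_inner_jacobi_smul_one]

theorem spectrum_jacobi_smul_one_subset (b : ℂ) :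
    spectrum ℂ (jacobi (b • 1)) ⊆ imagSegment b := by
  intro z hz
  by_contra hne
  obtain ⟨w, a, hw, h, ha⟩ := exists_halfPlane hne
  exact hz (mem_resolventSet_of_re_inner_le hw h ha)

theorem IsDiag.exists_finiteRank_rieszIntegral {D : H →L[ℂ] H} {d : ℤ → ℂ} (h : IsDiag D d)
    {b : ℂ} (hd : Filter.Tendsto d Filter.cofinite (nhds b)) {c : ℂ} (hc : c ∉ imagSegment b) :
    ∃ r₀ > 0, ∀ r, 0 < r → r < r₀ → Metric.closedBall c r ∩ spectrum ℂ (jacobi D) ⊆ {c} ∧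
      FiniteRank (rieszIntegral (resolvent (jacobi D)) c r) := by
  obtain ⟨w, a, hw, hL, ha⟩ := exists_halfPlane hc
  refine exists_finiteRank_rieszIntegral_of_re_inner_le hw hL (fun ε hε => ?_) ha
  -- `ε / 2` compensates for the factor `2` in `norm_jacobi_le`.
  obtain ⟨D₁, D₂, rfl, h1, h2, h3⟩ := h.exists_decomposition hd (half_pos hε)
  refine ⟨jacobi D₁, jacobi D₂, by rw [jacobi_add, jacobi_add], ?_, h2.jacobi h3⟩
  linarith [norm_jacobi_le D₁]

end Jacobi

/-! ### Plane waves and the essential spectrum of a slice. -/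

section EssentialSpectrum

local notation "H" => ℓ²(ℤ, ℂ)

/-- The truncated plane wave `∑_{M ≤ n < M + N} uⁿ eₙ`. -/
def planeWave (u : ℂ) (M : ℤ) (N : ℕ) : H :=
  ∑ n ∈ Finset.Ico M (M + N), lp.single 2 n (u ^ n)

theorem planeWave_apply (u : ℂ) (M : ℤ) (N : ℕ) (m : ℤ) :
    planeWave u M N m = if M ≤ m ∧ m < M + N then u ^ m else 0 := by
  rw [planeWave, lp.coeFn_sum, Finset.sum_apply]
  simp only [lp.coeFn_single, Pi.single_apply, Finset.sum_ite_eq, Finset.mem_Ico]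

theorem norm_sq_planeWave {u : ℂ} (hu : ‖u‖ = 1) (M : ℤ) (N : ℕ) :
    ‖planeWave u M N‖ ^ 2 = N := by
  have h := lp.norm_sum_single (E := fun _ : ℤ => ℂ) (p := 2) (by simp) (fun n => u ^ n)
    (Finset.Ico M (M + N))
  simp only [ENNReal.toReal_ofNat, norm_zpow, hu, one_zpow, Real.one_rpow, Finset.sum_const,
    Int.card_Ico, nsmul_eq_mul, mul_one, add_sub_cancel_left, Int.toNat_natCast] at h
  exact_mod_cast h

theorem jacobi_smul_one_apply (b : ℂ) (x : H) (n : ℤ) :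
    jacobi (b • 1) x n = b * x (n - 1) - conj b * x (n + 1) := by
  have : ContinuousLinearMap.adjoint (b • (1 : H →L[ℂ] H)) = conj b • 1 := by
    rw [map_smulₛₗ]
    congr 1
    exact ContinuousLinearMap.adjoint_id
  have h : jacobi (b • 1) x = shiftV (b • x) -
      ContinuousLinearMap.adjoint shiftV (conj b • x) := by
    simp only [jacobi, this]; rfl
  rw [h, lp.coeFn_sub, Pi.sub_apply, shiftV_apply, adjoint_shiftV_apply]
  rfl

/-- The full sequence `uⁿ` solves the eigenvalue equation formally. Truncation leaves four boundary
terms, each of norm `‖b‖`, so the error does not grow with `N`. -/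
theorem norm_jacobi_planeWave_le {u : ℂ} (hu : ‖u‖ = 1) (b : ℂ) (M : ℤ) (N : ℕ) :
    ‖jacobi (b • 1) (planeWave u M N) - (b * conj u - conj b * u) • planeWave u M N‖ ≤
      4 * ‖b‖ := by
  have hu0 : u ≠ 0 := by rintro rfl; simp at hu
  have hcu : conj u = u⁻¹ := by
    rw [eq_comm, inv_eq_iff_eq_inv, ← one_div, eq_div_iff (by simpa using hu0), Complex.mul_conj,
      Complex.normSq_eq_norm_sq, hu]
    simp
  set x := planeWave u M N with hx
  -- The case distinctions at the window's ends below need a nonempty window.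
  rcases Nat.eq_zero_or_pos N with rfl | hN
  · have : x = 0 := by
      ext m
      rw [hx, planeWave_apply, if_neg (by push_cast; omega)]
      rfl
    rw [this]
    simp
  have key : jacobi (b • 1) x - (b * conj u - conj b * u) • x =
      b • (lp.single 2 (M + N) (u ^ (M + N - 1)) - lp.single 2 M (u ^ (M - 1)) : H) +
      conj b • (lp.single 2 (M + N - 1) (u ^ (M + N)) - lp.single 2 (M - 1) (u ^ M) : H) := by
    ext m
    have e : (jacobi (b • 1) x - (b * conj u - conj b * u) • x) m =
      jacobi (b • 1) x m - (b * conj u - conj b * u) * x m := rfl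
    have e' : (b • (lp.single 2 (M + N) (u ^ (M + N - 1)) - lp.single 2 M (u ^ (M - 1)) : H) +
      conj b • (lp.single 2 (M + N - 1) (u ^ (M + N)) - lp.single 2 (M - 1) (u ^ M) : H) : H) m
      = b * ((if m = M + N then u ^ (M + N - 1) else 0) - if m = M then u ^ (M - 1) else 0) +
        conj b * ((if m = M + N - 1 then u ^ (M + N) else 0) -
          if m = M - 1 then u ^ M else 0) := by
      simp only [lp.coeFn_add, lp.coeFn_smul, lp.coeFn_sub, Pi.add_apply, Pi.smul_apply,
        Pi.sub_apply, lp.coeFn_single, Pi.single_apply, smul_eq_mul]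
    have h1 : x (m - 1) - u⁻¹ * x m =
        (if m = M + N then u ^ (M + N - 1) else 0) - if m = M then u ^ (M - 1) else 0 := by
      have hm : u ^ m = u * u ^ (m - 1) := by rw [zpow_sub_one₀ hu0]; field_simp
      rw [hx, planeWave_apply, planeWave_apply, hm]
      by_cases c1 : m = M + N
      · subst c1
        rw [if_pos (by omega), if_neg (by omega), if_pos rfl, if_neg (by omega)]; simp
      by_cases c2 : m = M
      · subst c2
        rw [if_neg (by omega), if_pos (by omega), if_neg c1, if_pos rfl]
        field_simp
      rw [if_neg c1, if_neg c2]
      by_cases c3 : M ≤ m ∧ m < M + N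
      · rw [if_pos (by omega), if_pos c3]; field_simp; ring
      · rw [if_neg (by omega), if_neg c3]; simp
    have h2 : u * x m - x (m + 1) =
        (if m = M + N - 1 then u ^ (M + N) else 0) - if m = M - 1 then u ^ M else 0 := by
      have hm : u ^ (m + 1) = u * u ^ m := by rw [zpow_add_one₀ hu0]; ring
      rw [hx, planeWave_apply, planeWave_apply, hm]
      by_cases c1 : m = M + N - 1
      · have hm' : u ^ (M + N : ℤ) = u * u ^ m := by rw [← hm]; congr 1; omega
        rw [if_pos (by omega), if_neg (by omega), if_pos c1, if_neg (by omega), hm']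
      by_cases c2 : m = M - 1
      · have hm' : u ^ M = u * u ^ m := by rw [← hm]; congr 1; omega
        rw [if_neg (by omega), if_pos (by omega), if_neg c1, if_pos c2, hm']; simp
      rw [if_neg c1, if_neg c2]
      by_cases c3 : M ≤ m ∧ m < M + N
      · rw [if_pos (by omega), if_pos (by omega)]; ring
      · rw [if_neg c3, if_neg (by omega)]; simp
    rw [e, e', jacobi_smul_one_apply, hcu, ← h1, ← h2]
    ring
  have hs : ∀ (k l : ℤ) , ‖(lp.single 2 k (u ^ l) : H)‖ = 1 := fun k l => by
    rw [lp.norm_single (by simp), norm_zpow, hu, one_zpow]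
  have hss : ∀ k l k' l' : ℤ, ‖(lp.single 2 k (u ^ l) - lp.single 2 k' (u ^ l') : H)‖ ≤ 2 :=
    fun k l k' l' => (norm_sub_le _ _).trans (by rw [hs, hs]; norm_num)
  rw [key]
  refine (norm_add_le _ _).trans ?_
  rw [norm_smul, norm_smul, RCLike.norm_conj]
  have hb := norm_nonneg b
  nlinarith [mul_le_mul_of_nonneg_left (hss (M + N) (M + N - 1) M (M - 1)) hb,
    mul_le_mul_of_nonneg_left (hss (M + N - 1) (M + N) (M - 1) M) hb]

theorem exists_unit_of_mem_imagSegment {b z : ℂ} (hz : z ∈ imagSegment b) :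
    ∃ u : ℂ, ‖u‖ = 1 ∧ z = b * conj u - conj b * u := by
  obtain ⟨t, ⟨ht1, ht2⟩, rfl⟩ := hz
  rcases eq_or_ne b 0 with rfl | hb
  · have : t = 0 := by simp at ht1 ht2; linarith
    exact ⟨1, by simp, by simp [this]⟩
  have hb' : 0 < ‖b‖ := norm_pos_iff.2 hb
  have hbc : (‖b‖ : ℂ) ≠ 0 := by exact_mod_cast hb'.ne'
  set s := Real.arcsin (t / (2 * ‖b‖)) with hs
  set v := Complex.exp (s * Complex.I) with hv
  have hvn : ‖v‖ = 1 := Complex.norm_exp_ofReal_mul_I s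
  have hvi : v - conj v = 2 * (Real.sin s) * Complex.I := by
    apply Complex.ext <;>
      simp [hv, Complex.exp_ofReal_mul_I_re, Complex.exp_ofReal_mul_I_im, -Complex.ofReal_sin]
    ring
  have hsin : 2 * ‖b‖ * Real.sin s = t := by
    rw [hs, Real.sin_arcsin]
    · field_simp
    · rw [le_div_iff₀ (by positivity)]; linarith
    · rw [div_le_iff₀ (by positivity)]; linarith
  have hbb : b * conj b = (‖b‖ : ℂ) ^ 2 := by
    rw [Complex.mul_conj, Complex.normSq_eq_norm_sq]; push_cast; rfl
  -- This `u` gives `b * conj u = ‖b‖ * v`, so the eigenvalue is `‖b‖ * (v - conj v) = 2i‖b‖ sin s`;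
  -- the arcsine was chosen to make this `i t`.
  refine ⟨conj v * b / ‖b‖, by simp [hvn, hb'.ne'], ?_⟩
  have h1 : b * conj (conj v * b / ‖b‖) = ‖b‖ * v := by
    simp only [map_div₀, map_mul, Complex.conj_conj, Complex.conj_ofReal]
    field_simp
    linear_combination v * hbb
  have h2 : conj b * (conj v * b / ‖b‖) = ‖b‖ * conj v := by
    field_simp
    linear_combination conj v * hbb
  rw [h1, h2, ← mul_sub, hvi, ← hsin]
  push_cast
  ring

/-- A Weyl sequence argument: push the window of a plane wave to where `d` is close to `b`, then
lengthen it. The norm grows like `√N`, whereas the boundary error stays bounded. -/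
theorem IsDiag.imagSegment_subset_spectrum {D : H →L[ℂ] H} {d : ℤ → ℂ} (h : IsDiag D d) {b : ℂ}
    (hd : Filter.Tendsto d Filter.cofinite (nhds b)) :
    imagSegment b ⊆ spectrum ℂ (jacobi D) := by
  intro z hz hzr
  obtain ⟨u, hu, rfl⟩ := exists_unit_of_mem_imagSegment hz
  obtain ⟨C, hC, hbd⟩ := exists_norm_le_of_mem_resolventSet hzr
  set D' := D - b • (1 : H →L[ℂ] H) with hD'
  have hD : D = b • 1 + D' := by rw [hD']; abel
  have hdiag : IsDiag D' fun n => d n - b := by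
    intro x m
    have : D' x m = D x m - b * x m := rfl
    rw [this, h]; ring
  -- With this value `C * (2 * δ * ‖x‖) = ‖x‖ / 2`, which is absorbed on the left in `h4`.
  set δ := 1 / (4 * C) with hδ
  have hδ0 : 0 < δ := by positivity
  have hev : ∀ᶠ n : ℤ in Filter.atTop, ‖d n - b‖ ≤ δ := by
    have := (Metric.tendsto_nhds.1 hd δ hδ0).filter_mono (Filter.atTop_le_cofinite (α := ℤ))
    filter_upwards [this] with n hn
    rw [← dist_eq_norm]; exact hn.le
  obtain ⟨M, hM⟩ := Filter.eventually_atTop.1 hev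
  obtain ⟨N, hN⟩ := exists_nat_gt ((8 * C * ‖b‖) ^ 2)
  set x := planeWave u M N with hx
  have hpt : ∀ n, ‖d n - b‖ * ‖x n‖ ≤ δ * ‖x n‖ := by
    intro n
    rw [hx, planeWave_apply]
    split_ifs with hn
    · gcongr
      exact hM n hn.1
    · simp
  have h1 : ‖D' x‖ ≤ δ * ‖x‖ := norm_le_mul_of_forall hδ0.le fun n => by
    rw [hdiag, norm_mul]; exact hpt n
  have h2 : ‖ContinuousLinearMap.adjoint D' x‖ ≤ δ * ‖x‖ :=
    norm_le_mul_of_forall hδ0.le fun n => by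
      rw [hdiag.adjoint, norm_mul, RCLike.norm_conj]; exact hpt n
  have h3 : ‖jacobi D x - (b * conj u - conj b * u) • x‖ ≤ 4 * ‖b‖ + 2 * δ * ‖x‖ := by
    have e : jacobi D x - (b * conj u - conj b * u) • x =
        (jacobi (b • 1) x - (b * conj u - conj b * u) • x) + jacobi D' x := by
      rw [hD, jacobi_add, add_apply]; abel
    rw [e]
    refine (norm_add_le _ _).trans (add_le_add (norm_jacobi_planeWave_le hu b M N) ?_)
    exact (norm_jacobi_apply_le _ _).trans (by linarith)
  have h4 : ‖x‖ ≤ 4 * C * ‖b‖ + ‖x‖ / 2 := by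
    refine (hbd x).trans ((mul_le_mul_of_nonneg_left h3 hC.le).trans (le_of_eq ?_))
    rw [hδ]; field_simp; ring
  have h5 : ‖x‖ ≤ 8 * C * ‖b‖ := by linarith
  have h6 := norm_sq_planeWave hu M N
  have h7 : ‖x‖ ^ 2 ≤ (8 * C * ‖b‖) ^ 2 := pow_le_pow_left₀ (norm_nonneg _) h5 2
  rw [hx, h6] at h7
  linarith

theorem spectrum_jacobi_smul_one (b : ℂ) : spectrum ℂ (jacobi (b • 1)) = imagSegment b :=
  (spectrum_jacobi_smul_one_subset b).antisymm
    (IsDiag.imagSegment_subset_spectrum (d := fun _ => b) (fun _ _ => rfl) tendsto_const_nhds)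

theorem exists_ne_mem_imagSegment {b z : ℂ} (hb : b ≠ 0) (hz : z ∈ imagSegment b) {r : ℝ}
    (hr : 0 < r) : ∃ z' ∈ imagSegment b, z' ≠ z ∧ z' ∈ Metric.closedBall z r := by
  obtain ⟨t, ⟨ht1, ht2⟩, rfl⟩ := hz
  have hb' : 0 < ‖b‖ := norm_pos_iff.2 hb
  have key : ∃ t' ∈ Set.Icc (-(2 * ‖b‖)) (2 * ‖b‖), t' ≠ t ∧ |t' - t| ≤ r := by
    have hm : 0 < min r ‖b‖ := lt_min hr hb'
    have h1 := min_le_left r ‖b‖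
    have h2 := min_le_right r ‖b‖
    rcases le_total t 0 with h | h
    · exact ⟨t + min r ‖b‖, ⟨by linarith, by linarith⟩, by
        intro h'; linarith, by rw [add_sub_cancel_left, abs_of_pos hm]; exact h1⟩
    · exact ⟨t - min r ‖b‖, ⟨by linarith, by linarith⟩, by
        intro h'; linarith, by rw [sub_sub_cancel_left, abs_neg, abs_of_pos hm]; exact h1⟩
  obtain ⟨t', ht', hne, hd⟩ := key
  refine ⟨_, ⟨t', ht', rfl⟩, ?_, ?_⟩
  · intro h
    exact hne (by simpa using h)
  · rw [Metric.mem_closedBall, dist_eq_norm, ← mul_sub, norm_mul, Complex.norm_I, one_mul,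
      ← Complex.ofReal_sub, Complex.norm_real]
    exact hd

theorem mem_discreteSpectrum_of_exists {E : Type*} [NormedAddCommGroup E] [NormedSpace ℂ E]
    {σ : Set ℂ} {R : ℂ → E →L[ℂ] E} {c : ℂ} (hc : c ∈ σ)
    (h : ∃ r₀ > 0, ∀ r, 0 < r → r < r₀ → Metric.closedBall c r ∩ σ ⊆ {c} ∧
      FiniteRank (rieszIntegral R c r)) : c ∈ discreteSpectrum σ R := by
  obtain ⟨r₀, h0, h⟩ := h
  obtain ⟨h1, h2⟩ := h (r₀ / 2) (half_pos h0) (half_lt_self h0)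
  exact ⟨r₀ / 2, half_pos h0, h1.antisymm
    (by rintro _ rfl; exact ⟨Metric.mem_closedBall_self (half_pos h0).le, hc⟩), h2⟩

/-- For `b ≠ 0` the segment is nondegenerate, so none of its points is isolated in the spectrum and
the rank condition is irrelevant there. -/
theorem IsDiag.essSpectrum_jacobi {D : H →L[ℂ] H} {d : ℤ → ℂ} (h : IsDiag D d) {b : ℂ}
    (hd : Filter.Tendsto d Filter.cofinite (nhds b)) (hb : b ≠ 0) :
    essSpectrum (jacobi D) = imagSegment b := by
  ext c
  constructor
  · rintro ⟨h1, h2⟩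
    by_contra hc
    exact h2 (mem_discreteSpectrum_of_exists h1 (h.exists_finiteRank_rieszIntegral hd hc))
  · intro hc
    refine ⟨h.imagSegment_subset_spectrum hd hc, ?_⟩
    rintro ⟨r, hr, hrc, -⟩
    obtain ⟨z, hz, hne, hzr⟩ := exists_ne_mem_imagSegment hb hc hr
    have : z ∈ ({c} : Set ℂ) := hrc ▸ ⟨hzr, h.imagSegment_subset_spectrum hd hz⟩
    exact hne this

theorem not_finiteRank_one : ¬ FiniteRank (1 : H →L[ℂ] H) := by
  intro h
  have h' : FiniteDimensional ℂ (LinearMap.range (LinearMap.id : H →ₗ[ℂ] H)) := h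
  rw [LinearMap.range_id] at h'
  have hfd : FiniteDimensional ℂ H := Module.Finite.equiv (Submodule.topEquiv (R := ℂ) (M := H))
  have hli : LinearIndependent ℂ fun n : ℤ => (lp.single 2 n (1 : ℂ) : H) := by
    rw [linearIndependent_iff']
    intro s g hg i hi
    have := congrArg (fun x : H => x i) hg
    simp only [lp.coeFn_sum, Finset.sum_apply, lp.coeFn_smul, Pi.smul_apply, lp.coeFn_single,
      Pi.single_apply, smul_eq_mul, mul_ite, mul_one, mul_zero, Finset.sum_ite_eq, hi,
      if_true] at this
    exact this
  have := hli.finite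
  exact not_finite ℤ

theorem imagSegment_zero : imagSegment 0 = {0} := by
  ext z
  constructor
  · rintro ⟨t, ⟨h1, h2⟩, rfl⟩
    have : t = 0 := by simp at h1 h2; linarith
    simp [this]
  · rintro rfl
    exact ⟨0, by simp, by simp⟩

theorem spectrum_zero_eq : spectrum ℂ (0 : H →L[ℂ] H) = {0} := by
  have : (0 : H →L[ℂ] H) = jacobi ((0 : ℂ) • 1) := by simp [jacobi]
  rw [this, spectrum_jacobi_smul_one, imagSegment_zero]

/-- The degenerate segment: `0` is isolated in the spectrum, but the resolvent is `z⁻¹`, so the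
Riesz projection is the identity and has infinite rank. -/
theorem essSpectrum_zero : essSpectrum (0 : H →L[ℂ] H) = {0} := by
  rw [essSpectrum, spectrum_zero_eq, sdiff_eq_left, Set.disjoint_singleton_left]
  rintro ⟨r, hr, -, hfin⟩
  have hres : ∀ z ∈ Metric.sphere (0 : ℂ) r,
      resolvent (0 : H →L[ℂ] H) z = (z - 0)⁻¹ • (1 : H →L[ℂ] H) := by
    intro z hz
    have hz0 : z ≠ 0 := by rintro rfl; simp [hr.ne] at hz
    refine (resolvent_eq_of_mul_eq_one ?_ ?_).2 <;>
      simp [Algebra.algebraMap_eq_smul_one, smul_smul, hz0]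
  have hint : rieszIntegral (resolvent (0 : H →L[ℂ] H)) 0 r = 1 := by
    rw [rieszIntegral, circleIntegral.integral_congr hr.le hres,
      circleIntegral.integral_smul_const, circleIntegral.integral_sub_center_inv _ hr.ne',
      smul_smul, inv_mul_cancel₀ Complex.two_pi_I_ne_zero, one_smul]
  rw [hint] at hfin
  exact not_finiteRank_one hfin

end EssentialSpectrum

/-! ### Direct sum decompositions of `ℓ²`. -/

section Sequences

variable {ι κ : Type*}

theorem memℓp_two_iff {f : ι → ℂ} : Memℓp f 2 ↔ Summable fun i => ‖f i‖ ^ 2 := by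
  rw [memℓp_gen_iff (by simp)]
  simp

theorem summable_norm_sq (x : ℓ²(ι, ℂ)) : Summable fun i => ‖x i‖ ^ 2 :=
  memℓp_two_iff.1 (lp.memℓp x)

theorem norm_sq_eq_tsum (x : ℓ²(ι, ℂ)) : ‖x‖ ^ 2 = ∑' i, ‖x i‖ ^ 2 := by
  have := lp.norm_rpow_eq_tsum (p := 2) (by simp) x
  simpa using this

theorem norm_le_mul_of_tsum_le {x : ℓ²(ι, ℂ)} {y : ℓ²(κ, ℂ)} {C : ℝ} (hC : 0 ≤ C)
    (h : ∑' i, ‖x i‖ ^ 2 ≤ C ^ 2 * ∑' j, ‖y j‖ ^ 2) : ‖x‖ ≤ C * ‖y‖ := by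
  rw [← norm_sq_eq_tsum, ← norm_sq_eq_tsum, ← mul_pow] at h
  exact le_of_sq_le_sq h (by positivity)

/-- Restriction of square summable sequences along an embedding of index sets. -/
def pullback (f : ι ↪ κ) : ℓ²(κ, ℂ) →L[ℂ] ℓ²(ι, ℂ) :=
  LinearMap.mkContinuous
    { toFun := fun x => ⟨fun i => x (f i),
        memℓp_two_iff.2 ((summable_norm_sq x).comp_injective f.injective)⟩
      map_add' := fun _ _ => rfl
      map_smul' := fun _ _ => rfl } 1 <| fun x => by
    refine norm_le_mul_of_tsum_le zero_le_one ?_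
    rw [one_pow, one_mul]
    exact tsum_comp_le_tsum_of_inj (summable_norm_sq x) (fun _ => by positivity) f.injective

theorem pullback_apply (f : ι ↪ κ) (x : ℓ²(κ, ℂ)) (i : ι) : pullback f x i = x (f i) := rfl

theorem norm_sq_extend (f : ι ↪ κ) (x : ι → ℂ) :
    (fun k => ‖Function.extend f x 0 k‖ ^ 2) = Function.extend f (fun i => ‖x i‖ ^ 2) 0 := by
  funext k
  by_cases hk : ∃ i, f i = k
  · obtain ⟨i, rfl⟩ := hk
    rw [f.injective.extend_apply, f.injective.extend_apply]
  · rw [Function.extend_apply' _ _ _ hk, Function.extend_apply' _ _ _ hk]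
    simp

/-- Extension of square summable sequences by zero along an embedding of index sets. -/
def pushforward (f : ι ↪ κ) : ℓ²(ι, ℂ) →L[ℂ] ℓ²(κ, ℂ) :=
  LinearMap.mkContinuous
    { toFun := fun x => ⟨Function.extend f x 0, memℓp_two_iff.2 (by
        rw [norm_sq_extend]
        exact (summable_extend_zero f.injective).2 (summable_norm_sq x))⟩
      map_add' := fun x y => by
        ext k
        change Function.extend f (fun i => x i + y i) 0 k =
          Function.extend f x 0 k + Function.extend f y 0 k
        by_cases hk : ∃ i, f i = k
        · obtain ⟨i, rfl⟩ := hk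
          simp only [f.injective.extend_apply]
        · simp [Function.extend_apply' _ _ _ hk]
      map_smul' := fun c x => by
        ext k
        change Function.extend f (fun i => c * x i) 0 k = c * Function.extend f x 0 k
        by_cases hk : ∃ i, f i = k
        · obtain ⟨i, rfl⟩ := hk
          simp only [f.injective.extend_apply]
        · simp [Function.extend_apply' _ _ _ hk] } 1 <| fun x => by
    refine norm_le_mul_of_tsum_le zero_le_one ?_
    rw [one_pow, one_mul]
    change ∑' k, ‖Function.extend f x 0 k‖ ^ 2 ≤ _
    rw [norm_sq_extend, tsum_extend_zero f.injective]

theorem pushforward_apply (f : ι ↪ κ) (x : ℓ²(ι, ℂ)) (i : ι) : pushforward f x (f i) = x i :=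
  f.injective.extend_apply _ _ _

theorem pushforward_apply' (f : ι ↪ κ) (x : ℓ²(ι, ℂ)) {k : κ} (hk : ∀ i, f i ≠ k) :
    pushforward f x k = 0 :=
  Function.extend_apply' _ _ _ (by rintro ⟨i, hi⟩; exact hk i hi)

theorem pullback_pushforward (f : ι ↪ κ) (x : ℓ²(ι, ℂ)) : pullback f (pushforward f x) = x := by
  ext i
  exact pushforward_apply f x i

variable {Q : Type*}

/-- The embedding of a fibre of a product decomposition. -/
def fibre (e : Q × ι ≃ κ) (q : Q) : ι ↪ κ := ⟨fun n => e (q, n), fun n m h => by simpa using h⟩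

theorem summable_norm_sq_fibre (e : Q × ι ≃ κ) (x : ℓ²(κ, ℂ)) :
    Summable fun q => ‖pullback (fibre e q) x‖ ^ 2 := by
  have h := (e.summable_iff (f := fun k => ‖x k‖ ^ 2)).2 (summable_norm_sq x)
  simp only [norm_sq_eq_tsum]
  exact ((summable_prod_of_nonneg fun _ => sq_nonneg _).1 h).2

theorem norm_sq_eq_tsum_fibre (e : Q × ι ≃ κ) (x : ℓ²(κ, ℂ)) :
    ‖x‖ ^ 2 = ∑' q, ‖pullback (fibre e q) x‖ ^ 2 := by
  have h := (e.summable_iff (f := fun k => ‖x k‖ ^ 2)).2 (summable_norm_sq x)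
  simp only [norm_sq_eq_tsum]
  rw [← e.tsum_eq (fun k => ‖x k‖ ^ 2)]
  exact h.tsum_prod' ((summable_prod_of_nonneg fun _ => sq_nonneg _).1 h).1

theorem ext_fibre (e : Q × ι ≃ κ) {x y : ℓ²(κ, ℂ)}
    (h : ∀ q, pullback (fibre e q) x = pullback (fibre e q) y) : x = y := by
  ext k
  obtain ⟨⟨q, n⟩, rfl⟩ := e.surjective k
  exact congrArg (fun z : ℓ²(ι, ℂ) => z n) (h q)

/-- The direct sum of a uniformly bounded family of operators on the fibres. -/
theorem exists_directSum (e : Q × ι ≃ κ) (A : Q → ℓ²(ι, ℂ) →L[ℂ] ℓ²(ι, ℂ)) {C : ℝ}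
    (hA : ∀ q, ‖A q‖ ≤ C) : ∃ R : ℓ²(κ, ℂ) →L[ℂ] ℓ²(κ, ℂ),
      ∀ q x, pullback (fibre e q) (R x) = A q (pullback (fibre e q) x) := by
  -- If `Q` is empty, `C` may be negative.
  have hA' : ∀ q, ‖A q‖ ≤ max C 0 := fun q => (hA q).trans (le_max_left _ _)
  have hbd : ∀ x q, ‖A q (pullback (fibre e q) x)‖ ^ 2 ≤
      (max C 0) ^ 2 * ‖pullback (fibre e q) x‖ ^ 2 := fun x q => by
    rw [← mul_pow]
    exact pow_le_pow_left₀ (norm_nonneg _) ((A q).le_of_opNorm_le (hA' q) _) 2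
  have hs : ∀ x, Summable fun q => ‖A q (pullback (fibre e q) x)‖ ^ 2 := fun x =>
    .of_nonneg_of_le (fun _ => by positivity) (hbd x) ((summable_norm_sq_fibre e x).mul_left _)
  let g : ℓ²(κ, ℂ) → κ → ℂ := fun x k =>
    A (e.symm k).1 (pullback (fibre e (e.symm k).1) x) (e.symm k).2
  have hg : ∀ x, Memℓp (g x) 2 := by
    intro x
    rw [memℓp_two_iff, ← e.summable_iff]
    refine (summable_prod_of_nonneg fun _ => sq_nonneg _).2 ⟨fun q => ?_, ?_⟩
    · simpa [g, Function.comp_def] using summable_norm_sq (A q (pullback (fibre e q) x))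
    · simpa [g, Function.comp_def, ← norm_sq_eq_tsum] using hs x
  let R₀ : ℓ²(κ, ℂ) →ₗ[ℂ] ℓ²(κ, ℂ) :=
    { toFun := fun x => ⟨g x, hg x⟩
      map_add' := fun x y => by
        ext k
        change g (x + y) k = g x k + g y k
        simp only [g, map_add]
        rfl
      map_smul' := fun c x => by
        ext k
        change g (c • x) k = c * g x k
        simp only [g, map_smul]
        rfl }
  have hR₀ : ∀ q x, pullback (fibre e q) (R₀ x) = A q (pullback (fibre e q) x) := by
    intro q x
    ext n
    change g x (e (q, n)) = _
    simp [g]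
  refine ⟨R₀.mkContinuous (max C 0) fun x => ?_, hR₀⟩
  refine le_of_sq_le_sq ?_ (by positivity)
  rw [norm_sq_eq_tsum_fibre e, mul_pow, norm_sq_eq_tsum_fibre e x, ← tsum_mul_left]
  simp only [hR₀]
  exact (hs x).tsum_le_tsum (hbd x) ((summable_norm_sq_fibre e x).mul_left _)

end Sequences

/-! ### Lattice geometry and the interaction coefficients. -/

section Grid

theorem eucNorm_eq_norm (k : ℤ × ℤ) : eucNorm k = ‖(k.1 + k.2 * Complex.I : ℂ)‖ := by
  have := Complex.norm_add_mul_I (k.1 : ℝ) (k.2 : ℝ)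
  push_cast at this
  rw [this, eucNorm]

theorem eucNorm_nonneg (k : ℤ × ℤ) : 0 ≤ eucNorm k := Real.sqrt_nonneg _

theorem eucNorm_sq (k : ℤ × ℤ) : eucNorm k ^ 2 = (k.1 : ℝ) ^ 2 + (k.2 : ℝ) ^ 2 :=
  Real.sq_sqrt (by positivity)

theorem one_le_eucNorm {p : ℤ × ℤ} (hp : p ≠ 0) : 1 ≤ eucNorm p := by
  have := one_le_eucNorm_sq hp
  nlinarith [eucNorm_nonneg p]

theorem tendsto_eucNorm_slice {p : ℤ × ℤ} (hp : p ≠ 0) (q : ℤ × ℤ) :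
    Filter.Tendsto (fun n : ℤ => eucNorm (q + n • p)) Filter.cofinite Filter.atTop := by
  have h1 : Filter.Tendsto (fun n : ℤ => ‖(n : ℝ)‖ - eucNorm q) Filter.cofinite Filter.atTop :=
    Filter.tendsto_atTop_add_const_right _ _
      (tendsto_norm_cocompact_atTop.comp Int.tendsto_coe_cofinite)
  refine Filter.tendsto_atTop_mono (fun n => ?_) h1
  have h2 : eucNorm (n • p) = ‖(n : ℝ)‖ * eucNorm p := by
    rw [eucNorm_eq_norm, eucNorm_eq_norm, ← Complex.norm_real, ← norm_mul]
    congr 1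
    simp only [Prod.smul_fst, Prod.smul_snd, smul_eq_mul]
    push_cast; ring
  have h3 : eucNorm (n • p) ≤ eucNorm (q + n • p) + eucNorm q := by
    rw [eucNorm_eq_norm, eucNorm_eq_norm (q + n • p), eucNorm_eq_norm q]
    refine le_trans (le_of_eq ?_) (norm_sub_le _ _)
    congr 1
    simp only [Prod.fst_add, Prod.snd_add]
    push_cast; ring
  have := one_le_eucNorm hp
  nlinarith [norm_nonneg (n : ℝ)]

theorem det2_slice (p q : ℤ × ℤ) (n : ℤ) : det2 (q + n • p) p = det2 q p := by
  simp only [det2, Prod.fst_add, Prod.snd_add, Prod.smul_fst, Prod.smul_snd, smul_eq_mul]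
  push_cast
  ring

/-- In the exceptional cases `k = 0` and `k = ±p` the determinant vanishes, so one formula serves
throughout, whatever the value of `1 / 0`. -/
theorem coefA_eq {p : ℤ × ℤ} (hp : p ≠ 0) (k : ℤ × ℤ) :
    coefA k p = 1 / 2 * (1 / eucNorm k ^ 2 - 1 / eucNorm p ^ 2) * det2 k p := by
  unfold coefA
  split_ifs with h
  · have : det2 k p = 0 := by
      rcases h with rfl | h | rfl | rfl
      · simp [det2]
      · exact absurd h hp
      · simp [det2]
      · simp [det2]
    rw [this, mul_zero]
  · rfl

theorem coefA_swap (p k : ℤ × ℤ) : coefA p k = coefA k p := by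
  have h1 : (p = 0 ∨ k = 0 ∨ p = k ∨ p = -k) ↔ (k = 0 ∨ p = 0 ∨ k = p ∨ k = -p) := by
    rw [eq_comm (a := p) (b := k), eq_neg_iff_add_eq_zero, eq_neg_iff_add_eq_zero,
      add_comm p k]
    tauto
  unfold coefA
  simp only [h1]
  split_ifs
  · rfl
  · simp only [det2]; ring

theorem coefA_neg (p k : ℤ × ℤ) : coefA (-p) k = -coefA p k := by
  have h1 : (-p = 0 ∨ k = 0 ∨ -p = k ∨ -p = -k) ↔ (p = 0 ∨ k = 0 ∨ p = k ∨ p = -k) := by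
    rw [neg_eq_zero, neg_inj, neg_eq_iff_eq_neg]
    tauto
  have h2 : eucNorm (-p) = eucNorm p := by simp [eucNorm]
  unfold coefA
  simp only [h1]
  split_ifs
  · simp
  · rw [h2]
    simp only [det2, Prod.fst_neg, Prod.snd_neg]
    push_cast
    ring

/-- Moves the base point of the slice to `q` itself, where the index of `q` becomes `0`. -/
theorem mem_reps_iff {p q : ℤ × ℤ} : q ∈ reps p ↔
    (∀ m : ℤ, eucNorm q ≤ eucNorm (q + m • p)) ∧
      ∀ m : ℤ, eucNorm q = eucNorm (q + m • p) → m ≤ 0 := by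
  constructor
  · rintro ⟨q₀, ⟨-, hmin⟩, n, hq, -, hmax⟩
    have key : ∀ m : ℤ, q + m • p = q₀ + (n + m) • p := fun m => by rw [hq, add_smul, add_assoc]
    refine ⟨fun m => hmin ⟨_, ⟨n + m, rfl⟩, by rw [key]⟩, fun m hm => ?_⟩
    have := hmax (show n + m ∈ {m : ℤ | eucNorm q = eucNorm (q₀ + m • p)} by
      rw [Set.mem_ofPred_eq, ← key]; exact hm)
    linarith
  · rintro ⟨h1, h2⟩
    refine ⟨q, ⟨⟨q, ⟨0, by simp⟩, rfl⟩, ?_⟩, 0, by simp, by simp, fun m hm => h2 m hm⟩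
    rintro _ ⟨_, ⟨m, rfl⟩, rfl⟩
    exact h1 m

/-- Norms tend to infinity along the slice, so sublevel sets are finite: choose a minimiser, then
the largest index within its sublevel set. -/
theorem exists_mem_reps {p : ℤ × ℤ} (hp : p ≠ 0) (k : ℤ × ℤ) :
    ∃ q ∈ reps p, ∃ n : ℤ, q + n • p = k := by
  have hfin : ∀ R : ℝ, {n : ℤ | eucNorm (k + n • p) ≤ R}.Finite := fun R => by
    have := (tendsto_eucNorm_slice hp k).eventually_gt_atTop R
    simpa only [not_lt] using Filter.eventually_cofinite.1 this
  obtain ⟨n₀, hn₀, hmin⟩ := Set.exists_min_image _ (fun n : ℤ => eucNorm (k + n • p))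
    (hfin (eucNorm k)) ⟨0, by simp⟩
  have hmin' : ∀ n : ℤ, eucNorm (k + n₀ • p) ≤ eucNorm (k + n • p) := by
    intro n
    by_cases h : eucNorm (k + n • p) ≤ eucNorm k
    · exact hmin n h
    · exact le_trans hn₀ (not_le.1 h).le
  obtain ⟨n₁, hn₁, hmax⟩ := Set.exists_max_image _ (fun n : ℤ => n)
    (hfin (eucNorm (k + n₀ • p))) ⟨n₀, le_refl (eucNorm (k + n₀ • p))⟩
  have e : ∀ m : ℤ, k + n₁ • p + m • p = k + (n₁ + m) • p := fun m => by
    rw [add_smul, add_assoc]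
  refine ⟨k + n₁ • p, mem_reps_iff.2 ⟨fun m => ?_, fun m hm => ?_⟩, -n₁, by simp⟩
  · rw [e]; exact le_trans hn₁ (hmin' _)
  · rw [e] at hm
    have := hmax (n₁ + m) (by rw [Set.mem_ofPred_eq, ← hm]; exact hn₁)
    linarith

theorem smul_injective {p : ℤ × ℤ} (hp : p ≠ 0) : Function.Injective fun n : ℤ => n • p :=
  smul_left_injective ℤ hp

/-- Both points have minimal norm, and maximality of the index at each of them gives `m ≤ 0` and `-m
≤ 0`. -/
theorem reps_unique {p q q' : ℤ × ℤ} (hq : q ∈ reps p) (hq' : q' ∈ reps p)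
    {m : ℤ} (h : q' = q + m • p) : q' = q := by
  rw [mem_reps_iff] at hq hq'
  have e : q = q' + (-m) • p := by rw [h]; simp
  have heq : eucNorm q = eucNorm q' := by
    refine le_antisymm ?_ ?_
    · rw [h]; exact hq.1 m
    · rw [e]; exact hq'.1 (-m)
  have h1 := hq.2 m (by rw [← h]; exact heq)
  have h2 := hq'.2 (-m) (by rw [← e]; exact heq.symm)
  have : m = 0 := by linarith
  rw [h, this]; simp

/-- Every lattice point is uniquely of the form `q + n p` with `q` a representative. -/
def gridEquiv {p : ℤ × ℤ} (hp : p ≠ 0) : reps p × ℤ ≃ ℤ × ℤ :=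
  Equiv.ofBijective (fun x => (x.1 : ℤ × ℤ) + x.2 • p) <| by
    constructor
    · rintro ⟨⟨q, hq⟩, n⟩ ⟨⟨q', hq'⟩, n'⟩ h
      change q + n • p = q' + n' • p at h
      have h1 : q' = q + (n - n') • p := by
        rw [sub_smul, ← add_sub_assoc, h, add_sub_cancel_right]
      have h2 := reps_unique hq hq' h1
      subst h2
      have h3 := smul_injective hp (add_left_cancel h)
      simp [h3]
    · intro k
      obtain ⟨q, hq, n, hn⟩ := exists_mem_reps hp k
      exact ⟨(⟨q, hq⟩, n), hn⟩

theorem finite_eucNorm_le (R : ℝ) : {q : ℤ × ℤ | eucNorm q ≤ R}.Finite := by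
  refine ((Set.finite_Icc (-⌈R⌉) ⌈R⌉).prod (Set.finite_Icc (-⌈R⌉) ⌈R⌉)).subset fun q hq => ?_
  have h1 : |(q.1 : ℝ)| ≤ R := le_trans (Real.abs_le_sqrt (by nlinarith [sq_nonneg (q.2 : ℝ)])) hq
  have h2 : |(q.2 : ℝ)| ≤ R := le_trans (Real.abs_le_sqrt (by nlinarith [sq_nonneg (q.1 : ℝ)])) hq
  have h3 := Int.le_ceil R
  rw [abs_le] at h1 h2
  refine ⟨⟨?_, ?_⟩, ?_, ?_⟩ <;> · rify; linarith

end Grid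

/-! ### The slice operators: limits and uniform resolvent bounds. -/

section Slices

local notation "H" => ℓ²(ℤ, ℂ)

theorem sliceL_eq_jacobi (p q : ℤ × ℤ) (Γ : ℂ) : sliceL p q Γ = jacobi (diagD p q Γ) := rfl

theorem isDiag_diagD (p q : ℤ × ℤ) (Γ : ℂ) :
    IsDiag (diagD p q Γ) fun n => coefA (q + n • p) p * Γ := fun _ _ => rfl

theorem sliceL0_eq_jacobi (p q : ℤ × ℤ) (Γ : ℂ) : sliceL0 p q Γ = jacobi (beta p q Γ • 1) := by
  ext x n
  rw [jacobi_smul_one_apply, ← shiftV_apply, ← adjoint_shiftV_apply]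
  rfl

theorem tendsto_coefA_slice {p : ℤ × ℤ} (hp : p ≠ 0) (q : ℤ × ℤ) (Γ : ℂ) :
    Filter.Tendsto (fun n : ℤ => (coefA (q + n • p) p * Γ : ℂ)) Filter.cofinite
      (nhds (beta p q Γ)) := by
  have h1 : Filter.Tendsto (fun n : ℤ => 1 / eucNorm (q + n • p) ^ 2) Filter.cofinite (nhds 0) := by
    simp only [one_div]
    exact ((Filter.tendsto_pow_atTop two_ne_zero).comp
      (tendsto_eucNorm_slice hp q)).inv_tendsto_atTop
  have h2 : Filter.Tendsto (fun n : ℤ => coefA (q + n • p) p) Filter.cofinite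
      (nhds (1 / 2 * (0 - 1 / eucNorm p ^ 2) * det2 q p)) := by
    simp only [coefA_eq hp, det2_slice]
    exact ((h1.sub_const _).const_mul _).mul_const _
  have h3 := ((Complex.continuous_ofReal.tendsto _).comp h2).mul_const Γ
  have e : beta p q Γ = ((1 / 2 * (0 - 1 / eucNorm p ^ 2) * det2 q p : ℝ) : ℂ) * Γ := by
    rw [beta]; push_cast; ring
  rw [e]
  exact h3

/-- Up to a nonzero constant `β` is `det2 q p * Γ`, a factor of every coefficient on the slice. -/
theorem sliceL_eq_zero {p q : ℤ × ℤ} (hp : p ≠ 0) {Γ : ℂ} (h : beta p q Γ = 0) :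
    sliceL p q Γ = 0 := by
  have h0 : (eucNorm p : ℂ) ≠ 0 := by
    have := one_le_eucNorm hp
    exact_mod_cast (by linarith : eucNorm p ≠ 0)
  have h1 : (det2 q p : ℂ) * Γ = 0 := by
    rw [beta, mul_assoc, mul_eq_zero] at h
    refine h.resolve_left ?_
    exact neg_ne_zero.2 (one_div_ne_zero (mul_ne_zero two_ne_zero (pow_ne_zero 2 h0)))
  have hD : diagD p q Γ = 0 := by
    ext x n
    rw [isDiag_diagD]
    beta_reduce
    rw [coefA_eq hp, det2_slice]
    push_cast
    rw [mul_assoc _ (det2 q p : ℂ), h1]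
    simp
  rw [sliceL, hD]
  simp

theorem essSpectrum_sliceL {p : ℤ × ℤ} (hp : p ≠ 0) (q : ℤ × ℤ) (Γ : ℂ) :
    essSpectrum (sliceL p q Γ) = imagSegment (beta p q Γ) := by
  by_cases h : beta p q Γ = 0
  · rw [sliceL_eq_zero hp h, h, imagSegment_zero, essSpectrum_zero]
  · exact (isDiag_diagD p q Γ).essSpectrum_jacobi (tendsto_coefA_slice hp q Γ) h

theorem imagSegment_subset_spectrum_sliceL {p : ℤ × ℤ} (hp : p ≠ 0) (q : ℤ × ℤ) (Γ : ℂ) :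
    imagSegment (beta p q Γ) ⊆ spectrum ℂ (sliceL p q Γ) :=
  (isDiag_diagD p q Γ).imagSegment_subset_spectrum (tendsto_coefA_slice hp q Γ)

theorem exists_finiteRank_rieszIntegral_sliceL {p : ℤ × ℤ} (hp : p ≠ 0) (q : ℤ × ℤ) (Γ : ℂ)
    {c : ℂ} (hc : c ∉ imagAxis) :
    ∃ r₀ > 0, ∀ r, 0 < r → r < r₀ → Metric.closedBall c r ∩ spectrum ℂ (sliceL p q Γ) ⊆ {c} ∧
      FiniteRank (rieszIntegral (resolvent (sliceL p q Γ)) c r) := by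
  refine (isDiag_diagD p q Γ).exists_finiteRank_rieszIntegral (tendsto_coefA_slice hp q Γ) ?_
  rintro ⟨t, -, rfl⟩
  exact hc (by simp [imagAxis])

theorem exists_isDiag (d : ℤ → ℂ) {K : ℝ} (hK : 0 ≤ K) (h : ∀ n, ‖d n‖ ≤ K) :
    ∃ D : H →L[ℂ] H, IsDiag D d :=
  ⟨lp.mapCLM 2 (fun n : ℤ => d n • ContinuousLinearMap.id ℂ ℂ) hK fun n => by
    rw [norm_smul, ContinuousLinearMap.norm_id, mul_one]; exact h n, fun _ _ => rfl⟩

theorem IsDiag.inner_eq {C : H →L[ℂ] H} {c : ℤ → ℝ} (h : IsDiag C fun n => (c n : ℂ)) {a : ℝ}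
    (hc : ∀ n, a ≤ c n) (x : H) :
    a * ‖x‖ ^ 2 ≤ (inner ℂ x (C x)).re ∧ (inner ℂ x (C x)).im = 0 := by
  have hs : HasSum (fun n => ((c n * ‖x n‖ ^ 2 : ℝ) : ℂ)) (inner ℂ x (C x)) := by
    have e : (fun n => ((c n * ‖x n‖ ^ 2 : ℝ) : ℂ)) = fun n => inner ℂ (x n) (C x n) := by
      funext n
      rw [h, RCLike.inner_apply, mul_assoc, Complex.mul_conj, Complex.normSq_eq_norm_sq]
      push_cast
      rfl
    rw [e]
    exact lp.hasSum_inner x (C x)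
  have hre := Complex.hasSum_re hs
  have him := Complex.hasSum_im hs
  simp only [Complex.ofReal_re] at hre
  simp only [Complex.ofReal_im] at him
  refine ⟨?_, him.unique hasSum_zero⟩
  have h2 : HasSum (fun n => a * ‖x n‖ ^ 2) (a * ‖x‖ ^ 2) := by
    rw [norm_sq_eq_tsum]
    exact (summable_norm_sq x).hasSum.mul_left a
  exact hasSum_le (fun n => mul_le_mul_of_nonneg_right (hc n) (sq_nonneg _)) h2 hre

/-- The operator `V γC - V* γ̄C` with a positive diagonal operator `C` has no spectrum off the
imaginary axis, with a resolvent bound depending only on the bounds of `C`. -/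
theorem norm_resolvent_jacobi_le {C : H →L[ℂ] H} {c : ℤ → ℝ} (h : IsDiag C fun n => (c n : ℂ))
    {a A : ℝ} (ha : 0 < a) (hac : ∀ n, a ≤ c n) (hcA : ∀ n, c n ≤ A) (γ : ℂ) {z : ℂ}
    (hz : z.re ≠ 0) :
    z ∈ resolventSet ℂ (jacobi (γ • C)) ∧
      ‖resolvent (jacobi (γ • C)) z‖ ≤ A / (a * |z.re|) := by
  have hA : 0 < A := ha.trans_le ((hac 0).trans (hcA 0))
  have hzpos : 0 < |z.re| := abs_pos.2 hz
  have hsa : ContinuousLinearMap.adjoint C = C := by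
    ext x n
    rw [h.adjoint, h]
    beta_reduce
    rw [Complex.conj_ofReal]
  have hCn : ‖C‖ ≤ A := h.norm_le hA.le fun n => by
    rw [Complex.norm_real, Real.norm_eq_abs, abs_of_pos (ha.trans_le (hac n))]; exact hcA n
  set T := jacobi (γ • C) with hT
  -- Because `C` is real, it can be pulled out on the right of both terms, leaving a skew-adjoint
  -- left factor.
  have hTC : ∀ x, T x = jacobi (γ • 1) (C x) := by
    intro x
    ext n
    have e : T x n = γ * C x (n - 1) - ContinuousLinearMap.adjoint (γ • C) x (n + 1) := by
      rw [← adjoint_shiftV_apply]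
      rfl
    rw [e, jacobi_smul_one_apply, map_smulₛₗ, hsa]
    rfl
  -- Pairing with `C x` instead of `x` makes the contribution of `T` purely imaginary, so the real
  -- part is `z.re` times the positive form of `C`.
  have hlow : ∀ x, a * |z.re| * ‖x‖ ^ 2 ≤ ‖inner ℂ (C x) (z • x - T x)‖ := by
    intro x
    obtain ⟨h1, h2⟩ := h.inner_eq hac x
    have e1 : inner ℂ (C x) x = inner ℂ x (C x) := by
      conv_lhs => rw [← hsa]
      exact ContinuousLinearMap.adjoint_inner_left C x x
    have e2 : (inner ℂ (C x) (z • x - T x)).re = z.re * (inner ℂ x (C x)).re := by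
      rw [inner_sub_right, Complex.sub_re, hTC, re_inner_jacobi_smul_one, sub_zero,
        inner_smul_right, Complex.mul_re, e1, h2, mul_zero, sub_zero]
    refine le_trans ?_ (Complex.abs_re_le_norm _)
    rw [e2, abs_mul]
    have := le_abs_self (inner ℂ x (C x)).re
    nlinarith
  -- Coercivity yields invertibility of `C * (z - T)`; cancelling `C` requires it to be a unit.
  have hCu : IsUnit C := by
    refine ContinuousLinearMap.isUnit_of_forall_le_norm_inner_map C (c := Real.toNNReal a)
      (Real.toNNReal_pos.2 ha) fun x => ?_
    rw [← inner_conj_symm, RCLike.norm_conj, Real.coe_toNNReal _ ha.le, mul_comm]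
    exact (h.inner_eq hac x).1.trans (Complex.re_le_norm _)
  have hu : IsUnit (C * (algebraMap ℂ (H →L[ℂ] H) z - T)) := by
    refine ContinuousLinearMap.isUnit_of_forall_le_norm_inner_map _
      (c := Real.toNNReal (a * |z.re|)) (Real.toNNReal_pos.2 (by positivity)) fun x => ?_
    rw [← inner_conj_symm, RCLike.norm_conj, Real.coe_toNNReal _ (by positivity), mul_comm]
    refine (hlow x).trans (le_of_eq ?_)
    congr 1
    change inner ℂ (C x) (z • x - T x) = inner ℂ x (C (z • x - T x))
    conv_lhs => rw [← hsa]
    exact ContinuousLinearMap.adjoint_inner_left C _ _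
  have hzT : z ∈ resolventSet ℂ T := by
    obtain ⟨u, hu'⟩ := hCu
    rw [← hu'] at hu
    exact (Units.isUnit_units_mul u _).1 hu
  refine ⟨hzT, ContinuousLinearMap.opNorm_le_bound _ (by positivity) fun y => ?_⟩
  set x := resolvent T z y with hx
  have hxy : z • x - T x = y := DFunLike.congr_fun (mul_resolvent hzT) y
  have h1 := hlow x
  rw [hxy] at h1
  have h2 : ‖inner ℂ (C x) y‖ ≤ A * ‖x‖ * ‖y‖ :=
    (norm_inner_le_norm _ _).trans (by gcongr; exact C.le_of_opNorm_le hCn x)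
  rcases eq_or_lt_of_le (norm_nonneg x) with h0 | h0
  · rw [← h0]; positivity
  · rw [div_mul_eq_mul_div, le_div_iff₀ (by positivity)]
    refine le_of_mul_le_mul_right ?_ h0
    nlinarith

/-- If the minimal norm on the slice exceeds `‖p‖`, all factors `1/‖p‖² - 1/‖q + np‖²` are positive.
The remaining factor `-det2 q p * Γ`, unbounded in `q`, goes into `γ`, which does not enter the
bound. -/
theorem norm_resolvent_sliceL_le {p : ℤ × ℤ} (hp : p ≠ 0) {z : ℂ} (hz : z.re ≠ 0) :
    ∃ C : ℝ, ∀ q ∈ reps p, eucNorm p < eucNorm q → ∀ Γ : ℂ,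
      z ∈ resolventSet ℂ (sliceL p q Γ) ∧ ‖resolvent (sliceL p q Γ) z‖ ≤ C := by
  set P := eucNorm p ^ 2 with hP
  have hP1 : 1 ≤ P := one_le_eucNorm_sq hp
  set a := 1 / 2 * (1 / P - 1 / (P + 1)) with ha
  set A := 1 / 2 * (1 / P) with hA
  have ha0 : 0 < a := by
    have : 1 / (P + 1) < 1 / P := one_div_lt_one_div_of_lt (by linarith) (by linarith)
    rw [ha]; linarith
  refine ⟨A / (a * |z.re|), fun q hq hpq Γ => ?_⟩
  -- Squared norms are integers, so a strict inequality gains `1`. This makes the lower bound `a`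
  -- independent of `q`.
  have hbig : ∀ n : ℤ, P + 1 ≤ eucNorm (q + n • p) ^ 2 := by
    intro n
    have h1 : eucNorm p < eucNorm (q + n • p) := hpq.trans_le ((mem_reps_iff.1 hq).1 n)
    have h2 : P < eucNorm (q + n • p) ^ 2 := pow_lt_pow_left₀ h1 (eucNorm_nonneg _) two_ne_zero
    rw [hP, eucNorm_sq, eucNorm_sq] at *
    exact_mod_cast h2
  set c : ℤ → ℝ := fun n => 1 / 2 * (1 / P - 1 / eucNorm (q + n • p) ^ 2) with hc
  have hac : ∀ n, a ≤ c n := fun n => by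
    have := one_div_le_one_div_of_le (by linarith : 0 < P + 1) (hbig n)
    simp only [hc, ha]; linarith
  have hcA : ∀ n, c n ≤ A := fun n => by
    have : 0 ≤ 1 / eucNorm (q + n • p) ^ 2 := by positivity
    simp only [hc, hA]; linarith
  obtain ⟨C, hC⟩ := exists_isDiag (fun n => (c n : ℂ)) (K := A) (by positivity) fun n => by
    rw [Complex.norm_real, Real.norm_eq_abs, abs_of_pos (ha0.trans_le (hac n))]; exact hcA n
  have hD : diagD p q Γ = (-(det2 q p) * Γ : ℂ) • C := by
    ext x n
    have e : ((-(det2 q p) * Γ : ℂ) • C) x n = (-(det2 q p) * Γ : ℂ) * C x n := rfl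
    rw [e, isDiag_diagD, hC]
    beta_reduce
    rw [coefA_eq hp, det2_slice]
    simp only [hc, hP]
    push_cast
    ring
  rw [sliceL_eq_jacobi, hD]
  exact norm_resolvent_jacobi_le hC ha0 hac hcA _ hz

theorem exists_mem_imagSegment_beta {p : ℤ × ℤ} (hp : p ≠ 0) {Γ : ℂ} (hΓ : Γ ≠ 0) {z : ℂ}
    (hz : z ∈ imagAxis) : ∃ q ∈ reps p, z ∈ imagSegment (beta p q Γ) := by
  have hΓ' : 0 < ‖Γ‖ := norm_pos_iff.2 hΓ
  obtain ⟨N, hN⟩ := exists_nat_ge (|z.im| / ‖Γ‖)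
  -- The slice through `N` times the rotated `p` has `det2 q p = N‖p‖²`, hence `2‖β‖ = N‖Γ‖`, which
  -- exceeds any given height.
  obtain ⟨q, hq, n, hn⟩ := exists_mem_reps hp ((N : ℤ) * p.2, -(N : ℤ) * p.1)
  have hP := one_le_eucNorm hp
  have hdet : det2 q p = N * eucNorm p ^ 2 := by
    rw [← det2_slice p q n, hn, eucNorm_sq, det2]
    push_cast
    ring
  have hb : 2 * ‖beta p q Γ‖ = N * ‖Γ‖ := by
    have : beta p q Γ = -(N / 2 : ℂ) * Γ := by
      have h0 : (eucNorm p : ℂ) ≠ 0 := by exact_mod_cast (by linarith : eucNorm p ≠ 0)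
      rw [beta, hdet]
      push_cast
      field_simp
    rw [this, norm_mul, norm_neg, norm_div, Complex.norm_natCast]
    simp only [Complex.norm_ofNat]
    ring
  refine ⟨q, hq, z.im, ?_, ?_⟩
  · rw [hb]
    rw [div_le_iff₀ hΓ'] at hN
    exact abs_le.1 hN
  · have hz' : z.re = 0 := hz
    apply Complex.ext <;> simp [hz']

end Slices

/-! ### Resolvents of unbounded operators. -/

section Unbounded

variable {E : Type*} [NormedAddCommGroup E] [NormedSpace ℂ E] {A : E →ₗ.[ℂ] E}

theorem IsResolventAt.unique {z : ℂ} {R R' : E →L[ℂ] E} (h : IsResolventAt A z R)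
    (h' : IsResolventAt A z R') : R = R' := by
  ext y
  have := h'.left_inv ⟨R y, h.mem_domain y⟩
  rw [h.right_inv] at this
  exact this.symm

theorem IsResolventAt.pmapResolvent_eq {z : ℂ} {R : E →L[ℂ] E} (h : IsResolventAt A z R) :
    pmapResolvent A z = R := by
  have hex : ∃ R, IsResolventAt A z R := ⟨R, h⟩
  rw [pmapResolvent, dif_pos hex]
  exact hex.choose_spec.unique h

theorem isResolventAt_pmapResolvent {z : ℂ} (h : z ∉ pmapSpectrum A) :
    IsResolventAt A z (pmapResolvent A z) := by
  obtain ⟨R, hR⟩ := not_not.1 h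
  rwa [hR.pmapResolvent_eq]

/-- From `(w - A)R = 1 + (w - z)R`: once the right side is invertible, so is `w - A`. -/
theorem IsResolventAt.perturb {z w : ℂ} {R : E →L[ℂ] E} (h : IsResolventAt A z R)
    (hu : IsUnit (1 + (w - z) • R)) :
    IsResolventAt A w (R * Ring.inverse (1 + (w - z) • R)) := by
  set N := 1 + (w - z) • R with hN
  have hcomm : R * Ring.inverse N = Ring.inverse N * R := by
    have hc : Commute R N := (Commute.one_right R).add_right ((Commute.refl R).smul_right _)
    calc R * Ring.inverse N = Ring.inverse N * N * R * Ring.inverse N := by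
          rw [Ring.inverse_mul_cancel N hu, one_mul]
      _ = Ring.inverse N * R * (N * Ring.inverse N) := by
          rw [mul_assoc _ N R, ← hc.eq]; noncomm_ring
      _ = Ring.inverse N * R := by rw [Ring.mul_inverse_cancel N hu, mul_one]
  have h1 : ∀ y, N (Ring.inverse N y) = y := fun y =>
    DFunLike.congr_fun (Ring.mul_inverse_cancel N hu) y
  have h2 : ∀ y, Ring.inverse N (N y) = y := fun y =>
    DFunLike.congr_fun (Ring.inverse_mul_cancel N hu) y
  have hNy : ∀ y, N y = y + (w - z) • R y := fun y => rfl
  refine ⟨fun y => h.mem_domain _, fun y => ?_, fun x => ?_⟩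
  · have e := h.right_inv (Ring.inverse N y)
    have e' : w • R (Ring.inverse N y) - A ⟨R (Ring.inverse N y), h.mem_domain _⟩ =
        N (Ring.inverse N y) := by
      rw [hNy, sub_smul, eq_comm, ← sub_eq_iff_eq_add'.2 (sub_eq_iff_eq_add.1 e)]
      abel
    exact e'.trans (h1 y)
  · rw [hcomm]
    change Ring.inverse N (R (w • (x : E) - A x)) = x
    have e : R (w • (x : E) - A x) = N x := by
      have : w • (x : E) - A x = (z • (x : E) - A x) + (w - z) • (x : E) := by
        rw [sub_smul]; abel
      rw [this, map_add, h.left_inv, map_smul, hNy]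
    rw [e, h2]

variable [CompleteSpace E]

/-- Supplies the circle integrability that lets the Riesz integral of `L` be restricted to slices.
-/
theorem continuousAt_pmapResolvent {z : ℂ} (hz : z ∉ pmapSpectrum A) :
    ContinuousAt (pmapResolvent A) z := by
  have h := isResolventAt_pmapResolvent hz
  set R := pmapResolvent A z with hR
  set N : ℂ → E →L[ℂ] E := fun w => 1 + (w - z) • R with hN
  have hNc : Continuous N := by fun_prop
  have hNz : N z = ((1 : (E →L[ℂ] E)ˣ) : E →L[ℂ] E) := by simp [hN]
  have hev : ∀ᶠ w in nhds z, IsUnit (N w) :=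
    hNc.continuousAt.eventually (by rw [hNz]; exact Units.nhds 1)
  have heq : pmapResolvent A =ᶠ[nhds z] fun w => R * Ring.inverse (N w) := by
    filter_upwards [hev] with w hw using (h.perturb hw).pmapResolvent_eq
  refine ContinuousAt.congr ?_ heq.symm
  have hinv : ContinuousAt (Ring.inverse : (E →L[ℂ] E) → _) (N z) := by
    rw [hNz]; exact NormedRing.inverse_continuousAt 1
  exact continuousAt_const.mul (hinv.comp hNc.continuousAt)

end Unbounded

/-! ### The decomposition of `L` into slices. -/

section DirectSum

variable {p : ℤ × ℤ}

/-- The embedding of `ℤ` onto `Σ_q`. -/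
def sliceEmb (hp : p ≠ 0) (q : ℤ × ℤ) : ℤ ↪ ℤ × ℤ :=
  ⟨fun n => q + n • p, fun _ _ h => smul_injective hp (add_left_cancel h)⟩

theorem sliceEmb_apply (hp : p ≠ 0) (q : ℤ × ℤ) (n : ℤ) : sliceEmb hp q n = q + n • p := rfl

theorem fibre_gridEquiv (hp : p ≠ 0) (q : reps p) : fibre (gridEquiv hp) q = sliceEmb hp q := rfl

theorem sliceL_apply (Γ : ℂ) (q : ℤ × ℤ) (x : ℓ²(ℤ, ℂ)) (n : ℤ) :
    sliceL p q Γ x n = coefA (q + (n - 1) • p) p * Γ * x (n - 1) -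
      coefA (q + (n + 1) • p) p * conj Γ * x (n + 1) := by
  have h : sliceL p q Γ x n = diagD p q Γ x (n - 1) -
      ContinuousLinearMap.adjoint (diagD p q Γ) x (n + 1) := by
    rw [← shiftV_apply, ← adjoint_shiftV_apply]
    rfl
  rw [h, isDiag_diagD, (isDiag_diagD p q Γ).adjoint]
  beta_reduce
  rw [map_mul, Complex.conj_ofReal]

/-- `k ± p` stays on the slice of `k`. The minus sign of `V*D*` comes from oddness of `A` in its
first argument, and symmetry of `A` swaps the arguments. -/
theorem formalL_slice (hp : p ≠ 0) (Γ : ℂ) (q : ℤ × ℤ) (ω : ℓ²(ℤ × ℤ, ℂ)) (n : ℤ) :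
    formalL p Γ ω (q + n • p) = sliceL p q Γ (pullback (sliceEmb hp q) ω) n := by
  have h1 : q + n • p - p = q + (n - 1) • p := by rw [sub_smul, one_smul, add_sub_assoc]
  have h2 : q + n • p + p = q + (n + 1) • p := by rw [add_smul, one_smul, add_assoc]
  rw [sliceL_apply, formalL, h1, h2, pullback_apply, pullback_apply, sliceEmb_apply,
    sliceEmb_apply, coefA_neg, coefA_swap p, coefA_swap p]
  push_cast
  ring

theorem pullback_eulerL (hp : p ≠ 0) (Γ : ℂ) (q : ℤ × ℤ) (ω : (eulerL p Γ).domain) :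
    pullback (sliceEmb hp q) (eulerL p Γ ω) =
      sliceL p q Γ (pullback (sliceEmb hp q) (ω : ℓ²(ℤ × ℤ, ℂ))) := by
  ext n
  exact formalL_slice hp Γ q _ n

theorem formalL_pushforward (hp : p ≠ 0) (Γ : ℂ) (q : ℤ × ℤ) (x : ℓ²(ℤ, ℂ)) :
    formalL p Γ (pushforward (sliceEmb hp q) x) =
      pushforward (sliceEmb hp q) (sliceL p q Γ x) := by
  funext k
  by_cases hk : ∃ n, sliceEmb hp q n = k
  · obtain ⟨n, rfl⟩ := hk
    rw [pushforward_apply, sliceEmb_apply, formalL_slice hp, pullback_pushforward]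
  · push Not at hk
    have h1 : ∀ n, sliceEmb hp q n ≠ k - p := fun n h => hk (n + 1) (by
      rw [sliceEmb_apply] at h ⊢
      rw [add_smul, one_smul, ← add_assoc, h, sub_add_cancel])
    have h2 : ∀ n, sliceEmb hp q n ≠ k + p := fun n h => hk (n - 1) (by
      rw [sliceEmb_apply] at h ⊢
      rw [sub_smul, one_smul, ← add_sub_assoc, h, add_sub_cancel_right])
    rw [pushforward_apply' _ _ hk, formalL, pushforward_apply' _ _ h1, pushforward_apply' _ _ h2]
    ring

theorem pushforward_mem_domain (hp : p ≠ 0) (Γ : ℂ) (q : ℤ × ℤ) (x : ℓ²(ℤ, ℂ)) :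
    pushforward (sliceEmb hp q) x ∈ (eulerL p Γ).domain := by
  change Memℓp (formalL p Γ (pushforward (sliceEmb hp q) x)) 2
  rw [formalL_pushforward]
  exact lp.memℓp _

theorem eulerL_pushforward (hp : p ≠ 0) (Γ : ℂ) (q : ℤ × ℤ) (x : ℓ²(ℤ, ℂ)) :
    eulerL p Γ ⟨pushforward (sliceEmb hp q) x, pushforward_mem_domain hp Γ q x⟩ =
      pushforward (sliceEmb hp q) (sliceL p q Γ x) := by
  apply lp.ext
  exact formalL_pushforward hp Γ q x

/-- Restriction and extension by zero intertwine `L` with `L_q`, so the compression of `R` to the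
slice inverts `z - L_q`. -/
theorem IsResolventAt.slice (hp : p ≠ 0) (Γ : ℂ) {z : ℂ} {R : ℓ²(ℤ × ℤ, ℂ) →L[ℂ] ℓ²(ℤ × ℤ, ℂ)}
    (h : IsResolventAt (eulerL p Γ) z R) (q : ℤ × ℤ) : z ∈ resolventSet ℂ (sliceL p q Γ) := by
  refine (resolvent_eq_of_mul_eq_one
    (b := pullback (sliceEmb hp q) ∘L R ∘L pushforward (sliceEmb hp q)) ?_ ?_).1
  · ext1 x
    have e := congrArg (pullback (sliceEmb hp q)) (h.right_inv (pushforward (sliceEmb hp q) x))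
    rw [map_sub, map_smul, pullback_eulerL, pullback_pushforward] at e
    exact e
  · ext1 x
    have e := h.left_inv ⟨_, pushforward_mem_domain hp Γ q x⟩
    rw [eulerL_pushforward, ← map_smul, ← map_sub] at e
    have e' := congrArg (pullback (sliceEmb hp q)) e
    rw [pullback_pushforward] at e'
    exact e'

/-- The uniform bound makes the direct sum `R` of the slice resolvents bounded. Its range lies in
the maximal domain, as `L(Rω) = zRω - ω` is square summable. -/
theorem exists_isResolventAt (hp : p ≠ 0) (Γ : ℂ) {z : ℂ} {C : ℝ}
    (h : ∀ q ∈ reps p, z ∈ resolventSet ℂ (sliceL p q Γ) ∧ ‖resolvent (sliceL p q Γ) z‖ ≤ C) :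
    ∃ R, IsResolventAt (eulerL p Γ) z R := by
  obtain ⟨R, hR⟩ := exists_directSum (gridEquiv hp)
    (fun q : reps p => resolvent (sliceL p q Γ) z) (fun q => (h q q.2).2)
  have hmul : ∀ (q : reps p) (x : ℓ²(ℤ, ℂ)), z • resolvent (sliceL p q Γ) z x -
      sliceL p q Γ (resolvent (sliceL p q Γ) z x) = x := fun q x =>
    DFunLike.congr_fun (mul_resolvent (h q q.2).1) x
  have hfor : ∀ ω, formalL p Γ (R ω) = z • (R ω : ℤ × ℤ → ℂ) - ω := by
    intro ω
    funext k
    obtain ⟨⟨q, n⟩, rfl⟩ := (gridEquiv hp).surjective k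
    have e1 : formalL p Γ (R ω) (gridEquiv hp (q, n)) =
        sliceL p q Γ (pullback (sliceEmb hp q) (R ω)) n := formalL_slice hp Γ q (R ω) n
    have e2 : sliceL p q Γ (pullback (sliceEmb hp q) (R ω)) =
        z • pullback (sliceEmb hp q) (R ω) - pullback (sliceEmb hp q) ω := by
      rw [← fibre_gridEquiv, hR, fibre_gridEquiv]
      nth_rewrite 3 [← hmul q (pullback (sliceEmb hp q) ω)]
      abel
    rw [e1, e2]
    rfl
  refine ⟨R, ⟨fun ω => ?_, fun ω => ?_, fun ω => ?_⟩⟩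
  · change Memℓp (formalL p Γ (R ω)) 2
    rw [hfor]
    exact ((lp.memℓp (R ω)).const_smul z).sub (lp.memℓp ω)
  · apply lp.ext
    change z • (R ω : ℤ × ℤ → ℂ) - formalL p Γ (R ω) = ω
    rw [hfor, sub_sub_cancel]
  · refine ext_fibre (gridEquiv hp) fun q => ?_
    rw [hR, fibre_gridEquiv, map_sub, map_smul, pullback_eulerL]
    exact DFunLike.congr_fun (resolvent_mul (h q q.2).1) _

theorem pullback_pmapResolvent (hp : p ≠ 0) (Γ : ℂ) {z : ℂ} (hz : z ∉ pmapSpectrum (eulerL p Γ)) (q : ℤ × ℤ)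
    (ω : ℓ²(ℤ × ℤ, ℂ)) : pullback (sliceEmb hp q) (pmapResolvent (eulerL p Γ) z ω) =
      resolvent (sliceL p q Γ) z (pullback (sliceEmb hp q) ω) := by
  have h := isResolventAt_pmapResolvent hz
  have e := congrArg (pullback (sliceEmb hp q)) (h.right_inv ω)
  rw [map_sub, map_smul, pullback_eulerL] at e
  rw [← e]
  exact (DFunLike.congr_fun (resolvent_mul (h.slice hp Γ q)) _).symm

theorem pmapSpectrum_eulerL (hp : p ≠ 0) (Γ : ℂ) :
    pmapSpectrum (eulerL p Γ) = ⋃ q ∈ reps p, spectrum ℂ (sliceL p q Γ) := by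
  apply Set.Subset.antisymm
  · intro z hz
    by_contra hne
    simp only [Set.mem_iUnion, not_exists] at hne
    have hne' : ∀ q ∈ reps p, z ∈ resolventSet ℂ (sliceL p q Γ) := fun q hq =>
      not_not.1 (hne q hq)
    suffices h : ∃ C : ℝ, ∀ q ∈ reps p, ‖resolvent (sliceL p q Γ) z‖ ≤ C by
      obtain ⟨C, hC⟩ := h
      exact hz (exists_isResolventAt hp Γ fun q hq => ⟨hne' q hq, hC q hq⟩)
    -- For `Γ = 0` the slices do not cover the imaginary axis, but all of them vanish and share one
    -- resolvent.
    by_cases hΓ : Γ = 0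
    · refine ⟨‖resolvent (0 : ℓ²(ℤ, ℂ) →L[ℂ] ℓ²(ℤ, ℂ)) z‖, fun q _ => ?_⟩
      rw [sliceL_eq_zero hp (by rw [beta, hΓ, mul_zero])]
    · have hre : z.re ≠ 0 := by
        intro h0
        obtain ⟨q, hq, hzq⟩ := exists_mem_imagSegment_beta hp hΓ (z := z) h0
        exact hne q hq (imagSegment_subset_spectrum_sliceL hp q Γ hzq)
      obtain ⟨C, hC⟩ := norm_resolvent_sliceL_le hp hre
      obtain ⟨C', hC'⟩ := ((finite_eucNorm_le (eucNorm p)).image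
        fun q => ‖resolvent (sliceL p q Γ) z‖).bddAbove
      refine ⟨max C C', fun q hq => ?_⟩
      rcases le_or_gt (eucNorm q) (eucNorm p) with h | h
      · exact (hC' ⟨q, h, rfl⟩).trans (le_max_right _ _)
      · exact (hC q hq h Γ).2.trans (le_max_left _ _)
  · refine Set.iUnion₂_subset fun q _ z hz hR => ?_
    obtain ⟨R, hR⟩ := hR
    exact hz (hR.slice hp Γ q)

end DirectSum

/-! ### Essential and point spectrum of `L`. -/

section EulerSpectrum

variable {p : ℤ × ℤ}

theorem finite_reps_le (p : ℤ × ℤ) : {q ∈ reps p | eucNorm q ≤ eucNorm p}.Finite :=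
  (finite_eucNorm_le (eucNorm p)).subset fun _ h => h.2

theorem pullback_pushforward_of_ne (hp : p ≠ 0) {q q' : ℤ × ℤ} (hq : q ∈ reps p)
    (hq' : q' ∈ reps p) (hne : q ≠ q') (x : ℓ²(ℤ, ℂ)) :
    pullback (sliceEmb hp q') (pushforward (sliceEmb hp q) x) = 0 := by
  ext n
  rw [pullback_apply, pushforward_apply']
  · rfl
  · intro m h
    rw [sliceEmb_apply, sliceEmb_apply] at h
    refine hne (reps_unique hq' hq (m := n - m) ?_)
    rw [sub_smul, ← add_sub_assoc, ← h, add_sub_cancel_right]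

theorem eucNorm_le_of_mem_spectrum (hp : p ≠ 0) {Γ : ℂ} {q : ℤ × ℤ} (hq : q ∈ reps p) {z : ℂ}
    (hz : z ∉ imagAxis) (h : z ∈ spectrum ℂ (sliceL p q Γ)) : eucNorm q ≤ eucNorm p := by
  by_contra hlt
  obtain ⟨_, hC⟩ := norm_resolvent_sliceL_le hp (z := z) hz
  exact h (hC q hq (not_le.1 hlt) Γ).1

/-- Off the axis only the finitely many slices with `‖q‖ ≤ ‖p‖` have spectrum, so a common radius
exists and the Riesz integral is the finite sum of theirs. -/
theorem exists_finiteRank_rieszIntegral_eulerL (hp : p ≠ 0) (Γ : ℂ) {c : ℂ} (hc : c ∉ imagAxis) :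
    ∃ r₀ > 0, ∀ r, 0 < r → r < r₀ → Metric.closedBall c r ∩ pmapSpectrum (eulerL p Γ) ⊆ {c} ∧
      FiniteRank (rieszIntegral (pmapResolvent (eulerL p Γ)) c r) := by
  have hre : 0 < |c.re| := abs_pos.2 hc
  choose ρ hρ hρr using fun q => exists_finiteRank_rieszIntegral_sliceL hp q Γ hc
  set s := (finite_reps_le p).toFinset with hs
  have hmem : ∀ q, q ∈ s ↔ q ∈ reps p ∧ eucNorm q ≤ eucNorm p := fun q => by simp [hs]
  -- The bound by `|c.re|` keeps every closed ball of radius `r < r₀` off the imaginary axis.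
  obtain ⟨r₀, hr₀, hr₀c, hr₀s⟩ : ∃ r₀ > 0, r₀ ≤ |c.re| ∧ ∀ q ∈ s, r₀ ≤ ρ q := by
    have h1 : ∀ᶠ r : ℝ in nhdsWithin 0 (Set.Ioi 0), ∀ q ∈ s, r ≤ ρ q :=
      (Filter.eventually_all_finset s).2 fun q _ =>
        (eventually_le_nhds (hρ q)).filter_mono nhdsWithin_le_nhds
    have h2 : ∀ᶠ r : ℝ in nhdsWithin 0 (Set.Ioi 0), r ≤ |c.re| :=
      (eventually_le_nhds hre).filter_mono nhdsWithin_le_nhds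
    obtain ⟨r, ⟨ha, hb⟩, hr⟩ := ((h1.and h2).and self_mem_nhdsWithin).exists
    exact ⟨r, hr, hb, ha⟩
  refine ⟨r₀, hr₀, fun r hr hrr => ?_⟩
  have hball : ∀ z ∈ Metric.closedBall c r, z ∉ imagAxis := by
    intro z hz h0
    have h1 : |(z - c).re| ≤ r := (Complex.abs_re_le_norm _).trans (by
      rwa [Metric.mem_closedBall, dist_eq_norm] at hz)
    have h0' : z.re = 0 := h0
    rw [Complex.sub_re, h0', zero_sub, abs_neg] at h1
    linarith
  have hiso : Metric.closedBall c r ∩ pmapSpectrum (eulerL p Γ) ⊆ {c} := by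
    rintro z ⟨hz, hzσ⟩
    rw [pmapSpectrum_eulerL hp] at hzσ
    obtain ⟨q, hq, hzq⟩ := Set.mem_iUnion₂.1 hzσ
    have hqs := (hmem q).2 ⟨hq, eucNorm_le_of_mem_spectrum hp hq (hball z hz) hzq⟩
    exact (hρr q r hr (hrr.trans_le (hr₀s q hqs))).1 ⟨hz, hzq⟩
  refine ⟨hiso, ?_⟩
  have hsph : ∀ z ∈ Metric.sphere c r, z ∉ pmapSpectrum (eulerL p Γ) := by
    intro z hz h
    have : z = c := hiso ⟨Metric.sphere_subset_closedBall hz, h⟩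
    rw [this] at hz
    simp [hr.ne] at hz
  have hint : CircleIntegrable (pmapResolvent (eulerL p Γ)) c r :=
    ContinuousOn.circleIntegrable hr.le fun z hz =>
      (continuousAt_pmapResolvent (hsph z hz)).continuousWithinAt
  have hslice : ∀ q ω, pullback (sliceEmb hp q)
      (rieszIntegral (pmapResolvent (eulerL p Γ)) c r ω) =
        rieszIntegral (resolvent (sliceL p q Γ)) c r (pullback (sliceEmb hp q) ω) := by
    intro q ω
    have hres : Metric.sphere c r ⊆ resolventSet ℂ (sliceL p q Γ) := fun z hz =>
      (isResolventAt_pmapResolvent (hsph z hz)).slice hp Γ q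
    have hint' : CircleIntegrable (resolvent (sliceL p q Γ)) c r :=
      ContinuousOn.circleIntegrable hr.le (differentiableOn_resolvent hres).continuousOn
    have e1 := circleIntegral_clm_comp
      (pullback (sliceEmb hp q) ∘L ContinuousLinearMap.apply ℂ ℓ²(ℤ × ℤ, ℂ) ω) hint
    have e2 := circleIntegral_clm_comp
      (ContinuousLinearMap.apply ℂ ℓ²(ℤ, ℂ) (pullback (sliceEmb hp q) ω)) hint'
    have e3 := circleIntegral.integral_congr (c := c) hr.le
      (fun z hz => pullback_pmapResolvent hp Γ (hsph z hz) q ω)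
    have e4 : pullback (sliceEmb hp q) ((∮ z in C(c, r), pmapResolvent (eulerL p Γ) z) ω) =
        (∮ z in C(c, r), resolvent (sliceL p q Γ) z) (pullback (sliceEmb hp q) ω) :=
      e1.symm.trans (e3.trans e2)
    rw [rieszIntegral, rieszIntegral, smul_apply, smul_apply, map_smul, e4]
  have hzero : ∀ q ∈ reps p, q ∉ s → rieszIntegral (resolvent (sliceL p q Γ)) c r = 0 := by
    intro q hq hqs
    refine rieszIntegral_eq_zero hr.le fun z hz => ?_
    by_contra hzq
    exact hqs ((hmem q).2 ⟨hq, eucNorm_le_of_mem_spectrum hp hq (hball z hz) hzq⟩)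
  have hsum : rieszIntegral (pmapResolvent (eulerL p Γ)) c r =
      ∑ q ∈ s, pushforward (sliceEmb hp q) ∘L
        rieszIntegral (resolvent (sliceL p q Γ)) c r ∘L pullback (sliceEmb hp q) := by
    ext1 ω
    refine ext_fibre (gridEquiv hp) fun q => ?_
    rw [fibre_gridEquiv, hslice, sum_apply, map_sum]
    have hother : ∀ q' ∈ s, q' ≠ q → pullback (sliceEmb hp q)
        ((pushforward (sliceEmb hp q') ∘L rieszIntegral (resolvent (sliceL p q' Γ)) c r ∘L
          pullback (sliceEmb hp q')) ω) = 0 := fun q' hq' hne =>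
      pullback_pushforward_of_ne hp ((hmem q').1 hq').1 q.2 hne _
    rw [Finset.sum_eq_single (q : ℤ × ℤ) hother]
    · exact (pullback_pushforward _ _).symm
    · intro hqs
      rw [hzero q q.2 hqs]
      simp
  rw [hsum]
  refine FiniteRank.sum _ fun q hq => ?_
  have hfin : FiniteDimensional ℂ (LinearMap.range
      (rieszIntegral (resolvent (sliceL p q Γ)) c r : ℓ²(ℤ, ℂ) →ₗ[ℂ] ℓ²(ℤ, ℂ))) :=
    (hρr q r hr (hrr.trans_le (hr₀s q hq))).2
  exact .of_range_le ((LinearMap.range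
    (rieszIntegral (resolvent (sliceL p q Γ)) c r : ℓ²(ℤ, ℂ) →ₗ[ℂ] ℓ²(ℤ, ℂ))).map
      (pushforward (sliceEmb hp q) : ℓ²(ℤ, ℂ) →ₗ[ℂ] ℓ²(ℤ × ℤ, ℂ)))
    fun ω => ⟨_, ⟨pullback (sliceEmb hp q) ω, rfl⟩, rfl⟩

theorem pmapEssSpectrum_eulerL (hp : p ≠ 0) {Γ : ℂ} (hΓ : Γ ≠ 0) :
    pmapEssSpectrum (eulerL p Γ) = imagAxis := by
  ext c
  constructor
  · rintro ⟨h1, h2⟩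
    by_contra hc
    exact h2 (mem_discreteSpectrum_of_exists h1 (exists_finiteRank_rieszIntegral_eulerL hp Γ hc))
  · intro hc
    have hsub : imagAxis ⊆ pmapSpectrum (eulerL p Γ) := by
      intro z hz
      obtain ⟨q, hq, hzq⟩ := exists_mem_imagSegment_beta hp hΓ hz
      rw [pmapSpectrum_eulerL hp]
      exact Set.mem_iUnion₂.2 ⟨q, hq, imagSegment_subset_spectrum_sliceL hp q Γ hzq⟩
    refine ⟨hsub hc, ?_⟩
    rintro ⟨r, hr, hrc, -⟩
    have hc' : c.re = 0 := hc
    -- The whole axis is spectrum, so this second point of the ball shows that `c` is not isolated.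
    have hz : c + r * Complex.I ∈ imagAxis := by simp [imagAxis, hc']
    have hzr : c + r * Complex.I ∈ Metric.closedBall c r := by
      simp [abs_of_pos hr]
    have : c + r * Complex.I ∈ ({c} : Set ℂ) := hrc ▸ ⟨hzr, hsub hz⟩
    simp [hr.ne'] at this

theorem pointSpectrum_subset_spectrum {E : Type*} [NormedAddCommGroup E] [NormedSpace ℂ E]
    (T : E →L[ℂ] E) : pointSpectrum T ⊆ spectrum ℂ T := by
  intro z hz hzr
  obtain ⟨x, hx⟩ := Module.End.HasEigenvalue.exists_hasEigenvector hz
  obtain ⟨C, -, hC⟩ := exists_norm_le_of_mem_resolventSet hzr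
  have h1 : T x = z • x := hx.apply_eq_smul
  have h2 := hC x
  rw [h1, sub_self, norm_zero, mul_zero] at h2
  exact hx.2 (norm_le_zero_iff.1 h2)

/-- An eigenvector of `L` restricts to an eigenvector on any slice where it is nonzero, and one of a
slice extends by zero. The bound on `‖q‖` is automatic, as other slices have no spectrum off the
axis. -/
theorem pmapPointSpectrum_eulerL (hp : p ≠ 0) (Γ : ℂ) :
    pmapPointSpectrum (eulerL p Γ) \ imagAxis =
      ⋃ q ∈ {q ∈ reps p | eucNorm q ≤ eucNorm p},
        (pointSpectrum (sliceL p q Γ) \ imagAxis) := by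
  ext z
  rw [Set.mem_iUnion₂]
  constructor
  · rintro ⟨⟨x, hx0, hx⟩, hz⟩
    obtain ⟨q, hq⟩ : ∃ q : reps p, pullback (sliceEmb hp q) (x : ℓ²(ℤ × ℤ, ℂ)) ≠ 0 := by
      by_contra! h
      refine hx0 (ext_fibre (gridEquiv hp) fun q => ?_)
      rw [fibre_gridEquiv, h q, map_zero]
    have he : z ∈ pointSpectrum (sliceL p q Γ) := by
      refine Module.End.hasEigenvalue_of_hasEigenvector (x := pullback (sliceEmb hp q)
        (x : ℓ²(ℤ × ℤ, ℂ))) ⟨Module.End.mem_eigenspace_iff.2 ?_, hq⟩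
      have := pullback_eulerL hp Γ q x
      rw [hx, map_smul] at this
      exact this.symm
    exact ⟨q, ⟨q.2, eucNorm_le_of_mem_spectrum hp q.2 hz (pointSpectrum_subset_spectrum _ he)⟩,
      he, hz⟩
  · rintro ⟨q, -, he, hz⟩
    refine ⟨?_, hz⟩
    obtain ⟨x, hx⟩ := Module.End.HasEigenvalue.exists_hasEigenvector he
    have h1 : sliceL p q Γ x = z • x := hx.apply_eq_smul
    refine ⟨⟨_, pushforward_mem_domain hp Γ q x⟩, fun h0 => hx.2 ?_, ?_⟩
    · rw [← pullback_pushforward (sliceEmb hp q) x]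
      exact (congrArg (pullback (sliceEmb hp q)) h0).trans (map_zero _)
    · rw [eulerL_pushforward, h1, map_smul]

end EulerSpectrum

end LinEuler

end

open LinEuler
theorem theorem3 (p : ℤ × ℤ) (hp : p ≠ 0) (Γ : ℂ) :
    (∀ q ∈ reps p,
      essSpectrum (sliceL p q Γ) = spectrum ℂ (sliceL0 p q Γ) ∧
      spectrum ℂ (sliceL0 p q Γ) =
        {z : ℂ | ∃ t ∈ Set.Icc (-(2 * ‖beta p q Γ‖)) (2 * ‖beta p q Γ‖),
          z = Complex.I * (t : ℂ)}) ∧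
    pmapSpectrum (eulerL p Γ) = ⋃ q ∈ reps p, spectrum ℂ (sliceL p q Γ) ∧
    (Γ ≠ 0 → pmapEssSpectrum (eulerL p Γ) = imagAxis) ∧
    pmapPointSpectrum (eulerL p Γ) \ imagAxis =
      ⋃ q ∈ {q ∈ reps p | eucNorm q ≤ eucNorm p},
        (pointSpectrum (sliceL p q Γ) \ imagAxis) ∧
    Bornology.IsBounded (pmapPointSpectrum (eulerL p Γ) \ imagAxis) ∧
    ∀ z : ℂ, AccPt z (Filter.principal (pmapPointSpectrum (eulerL p Γ) \ imagAxis)) →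
      z ∈ imagAxis := by
  have hpt := pmapPointSpectrum_eulerL hp Γ
  refine ⟨fun q _ => ⟨?_, ?_⟩, pmapSpectrum_eulerL hp Γ, pmapEssSpectrum_eulerL hp, hpt, ?_, ?_⟩
  · rw [essSpectrum_sliceL hp, sliceL0_eq_jacobi, spectrum_jacobi_smul_one]
  · rw [sliceL0_eq_jacobi, spectrum_jacobi_smul_one]
    rfl
  · rw [hpt, Bornology.isBounded_biUnion (finite_reps_le p)]
    exact fun q _ => (spectrum.isBounded (sliceL p q Γ)).subset
      (Set.sdiff_subset.trans (pointSpectrum_subset_spectrum _))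
  -- Off the axis, a small closed ball about `z` contains no point of the spectrum other than
  -- possibly `z`, which rules out accumulation of eigenvalues.
  · intro z hz
    by_contra hzi
    obtain ⟨r₀, hr₀, h⟩ := exists_finiteRank_rieszIntegral_eulerL hp Γ hzi
    obtain ⟨y, ⟨hyr, hy⟩, hne⟩ := accPt_iff_nhds.1 hz _
      (Metric.closedBall_mem_nhds z (half_pos hr₀))
    refine hne ((h _ (half_pos hr₀) (half_lt_self hr₀)).1 ⟨hyr, ?_⟩)
    rw [hpt] at hy
    obtain ⟨q, hq, hyq⟩ := Set.mem_iUnion₂.1 hy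
    rw [pmapSpectrum_eulerL hp]
    exact Set.mem_iUnion₂.2 ⟨q, hq.1, pointSpectrum_subset_spectrum _ hyq.1⟩
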